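/- Let $M$ be a smooth manifold with a step $2$ sub-Riemannian structure: a smooth rank $h$ distribution $H\subseteq TM$ with $[H,H]=TM$ at every point and a smooth inner product $\langle\cdot,\cdot\rangle$ on $H$. For a covector $\xi$ that annihilates $H$ (write $\xi\in V^*$) let $\mathcal J(\xi)\in\operatorname{End}(H)$ be given by $\langle \mathcal J(\xi)X,Y\rangle=d\xi(X,Y)$. On $\operatorname{End}(H)$ use $\langle A,B\rangle=\operatorname{tr}(B^{\top}A)$, and on $V^*$ the inner product $\langle\xi,\eta\rangle=\frac1h\langle\mathcal J(\xi),\mathcal J(\eta)\rangle$. Assume that $M$ is quaternionic contact: locally $V^*$ has a smooth frame $\eta^1,\eta^2,\eta^3$ such that $J_a=\mathcal J(\eta^a)$ satisfy $J_1^2=J_2^2=J_3^2=J_1J_2J_3=-1$. Assume moreover that $M$ is integrable: $h>4$, or there is a complement $W$ of $H$ such that $d\eta^a(U_b,X)+d\eta^b(U_a,X)=0$ for all $a,b$ and all $X\in H$, for every such local frame with dual frame $U_1,U_2,U_3$ of $W$. Let $V$ and $\nabla$ be the Biquard complement and connection. That is, $TM=H\oplus V$; $g$ is the Riemannian metric that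 extends $\langle\cdot,\cdot\rangle$, makes $H$ and $V$ orthogonal and is on $V$ the dual of the inner product of $V^*$; $H$, $V$, $g$ and $\mathcal J$ are parallel for $\nabla$; the torsion satisfies $\mathrm{Tor}(H,H)\subseteq V$ and $\mathrm{Tor}(H,V)\subseteq H$; and for $U\in V$ the operator $\mathrm{Tor}(U,\cdot)\colon H\to H$ lies in $\mathfrak t^{\perp}\oplus\Sigma$. Here $\Sigma$ is the space of symmetric endomorphisms of $H$, $\mathfrak t=\mathfrak t_0\oplus\mathfrak{sp}_1$ with $\mathfrak{sp}_1=\mathcal J(V^*)$ and $\mathfrak t_0$ its centralizer in $\mathfrak{so}(H)$, and $\mathfrak t^\perp$ is the orthogonal complement of $\mathfrak t$ in $\mathfrak{so}(H)$. Suppose that the distribution $V$ is integrable (involutive). Let $U_1,U_2,U_3$ be a local orthonormal frame of $V$ with dual coframe $\eta^1,\eta^2,\eta^3\in V^*$, oriented so that $J_1J_2J_3=-1$. Let $T_a=\mathrm{Tor}(U_a,\cdot)\colon H\to H$ have symmetric part $T_a^{\Sigma}$ and skew-symmetric part $T_a^{o}$, let $\tau=-\eta^3(\mathrm{Tor}(U_1,U_2))$,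 and let $\mathrm{Rc}^V(A,B)=\sum_{d=1}^3 g(R(U_d,A)B,U_d)$, where $R(X,Y)=[\nabla_X,\nabla_Y]-\nabla_{[X,Y]}$. Then, for all $a,b,c\in\{1,2,3\}$ with $J_aJ_bJ_c=-1$, $$\mathrm{Rc}^V(U_a,U_b)=\frac4h\langle T_a^{o},T_b^{o}\rangle-\frac4h\langle T_a^{\Sigma},T_b^{\Sigma}\rangle+\frac12\,d\tau(U_c).$$ -/

import Mathlib

open scoped Manifold ContDiff

noncomputable section

namespace QC

/-! ### Vector fields, one-forms, subbundles -/

section Basic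

variable {n : ℕ} {M : Type*} [TopologicalSpace M] [ChartedSpace (EuclideanSpace ℝ (Fin n)) M]

variable (n M) in
/-- Vector fields on `M` (no regularity). -/
abbrev VField : Type _ := Π p : M, TangentSpace (𝓡 n) p

variable (n M) in
/-- One-forms on `M` (no regularity). -/
abbrev OneForm : Type _ := Π p : M, TangentSpace (𝓡 n) p →L[ℝ] ℝ

variable (n M) in
/-- Families of subspaces of the tangent spaces. -/
abbrev Distribution : Type _ := Π p : M, Submodule ℝ (TangentSpace (𝓡 n) p)

/-- The vector field underlying a section of a distribution. A section of a subbundle over an open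
set `O` is a total family `X : Π q, F q`, with regularity required on `O` only. -/
abbrev toField {F : Distribution n M} (X : Π q : M, F q) : VField n M :=
  fun q ↦ (X q : TangentSpace (𝓡 n) q)

/-- Kronecker delta. -/
abbrev delta {k : ℕ} (i j : Fin k) : ℝ := if i = j then 1 else 0

/-- `X` is a smooth vector field on `O`. -/
def SmoothField [IsManifold (𝓡 n) ∞ M] (X : VField n M) (O : Set M) : Prop :=
  ContMDiffOn (𝓡 n) ((𝓡 n).prod 𝓘(ℝ, EuclideanSpace ℝ (Fin n))) ∞
    (fun q ↦ (⟨q, X q⟩ : TangentBundle (𝓡 n) M)) O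

/-- `f` is a smooth function on `O`. -/
def SmoothFun (f : M → ℝ) (O : Set M) : Prop :=
  ContMDiffOn (𝓡 n) 𝓘(ℝ, ℝ) ∞ f O

/-- The derivative of the function `f` at `p`. -/
abbrev dFun (f : M → ℝ) (p : M) : TangentSpace (𝓡 n) p →L[ℝ] ℝ := mvfderiv (𝓡 n) f p

/-- `ξ` is a smooth one-form on `O`: it takes smooth vector fields to smooth functions. -/
def SmoothForm [IsManifold (𝓡 n) ∞ M] (ξ : OneForm n M) (O : Set M) : Prop :=
  ∀ O' : Set M, IsOpen O' → O' ⊆ O → ∀ X : VField n M, SmoothField X O' →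
    SmoothFun (n := n) (fun q ↦ ξ q (X q)) O'

/-- The exterior derivative `dξ(X, Y) = X ξ(Y) - Y ξ(X) - ξ([X, Y])` at `p`. -/
def dForm (ξ : OneForm n M) (X Y : VField n M) (p : M) : ℝ :=
  dFun (fun q ↦ ξ q (Y q)) p (X p) - dFun (fun q ↦ ξ q (X q)) p (Y p)
    - ξ p (VectorField.mlieBracket (𝓡 n) X Y p)

/-- `F` is a smooth rank `k` subbundle of `TM`. -/
def IsSmoothSubbundle [IsManifold (𝓡 n) ∞ M] (k : ℕ) (F : Distribution n M) : Prop :=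
  (∀ p, Module.finrank ℝ (F p) = k) ∧
  ∀ p, ∃ O : Set M, IsOpen O ∧ p ∈ O ∧ ∃ X : Fin k → Π q : M, F q,
    (∀ i, SmoothField (toField (X i)) O) ∧ ∀ q ∈ O, LinearIndependent ℝ (fun i ↦ X i q)

/-- Involutivity (Frobenius integrability) of a distribution. -/
def IsInvolutive [IsManifold (𝓡 n) ∞ M] (F : Distribution n M) : Prop :=
  ∀ O : Set M, IsOpen O → ∀ X Y : Π q : M, F q,
    SmoothField (toField X) O → SmoothField (toField Y) O →
    ∀ p ∈ O, VectorField.mlieBracket (𝓡 n) (toField X) (toField Y) p ∈ F p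

/-- Affine connections on `M`; `nabla Y p v` is the covariant derivative of `Y` along `v` at `p`. -/
abbrev Connection (n : ℕ) (M : Type*) [TopologicalSpace M]
    [ChartedSpace (EuclideanSpace ℝ (Fin n)) M] [IsManifold (𝓡 n) ∞ M] : Type _ :=
  CovariantDerivative (𝓡 n) (EuclideanSpace ℝ (Fin n)) (TangentSpace (𝓡 n) : M → Type _)

/-- The vector field `∇_X Y`. -/
def Connection.along [IsManifold (𝓡 n) ∞ M] (nabla : Connection n M) (X Y : VField n M) :
    VField n M :=
  fun q ↦ nabla Y q (X q)

/-- The curvature `R(X, Y)Z = ∇_X ∇_Y Z - ∇_Y ∇_X Z - ∇_{[X, Y]} Z`. -/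
def Connection.curvature [IsManifold (𝓡 n) ∞ M] (nabla : Connection n M) (X Y Z : VField n M) :
    VField n M :=
  nabla.along X (nabla.along Y Z) - nabla.along Y (nabla.along X Z)
    - nabla.along (VectorField.mlieBracket (𝓡 n) X Y) Z

end Basic

/-! ### Matrices, i.e. endomorphisms of `H` in an orthonormal frame -/

section Matrices

variable {h : ℕ}

/-- The inner product `⟨A, B⟩ = tr (Bᵀ A)` on `𝔤𝔩_h`. -/
def matInner (A B : Matrix (Fin h) (Fin h) ℝ) : ℝ := (B.transpose * A).trace

/-- The symmetric part of a matrix. -/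
def symPart (A : Matrix (Fin h) (Fin h) ℝ) : Matrix (Fin h) (Fin h) ℝ :=
  (1 / 2 : ℝ) • (A + A.transpose)

/-- The skew-symmetric part of a matrix. -/
def skewPart (A : Matrix (Fin h) (Fin h) ℝ) : Matrix (Fin h) (Fin h) ℝ :=
  (1 / 2 : ℝ) • (A - A.transpose)

/-- `𝔱 = 𝔱₀ ⊕ 𝔰𝔭₁`, where `𝔱₀` is the centralizer of `𝔰𝔭₁` in `𝔰𝔬_h`. -/
def tAlg (sp : Submodule ℝ (Matrix (Fin h) (Fin h) ℝ)) : Set (Matrix (Fin h) (Fin h) ℝ) :=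
  {C | ∃ C₀ C₁ : Matrix (Fin h) (Fin h) ℝ, C₀.transpose = -C₀ ∧ (∀ B ∈ sp, C₀ * B = B * C₀) ∧
    C₁ ∈ sp ∧ C = C₀ + C₁}

/-- Membership in `𝔱^⊥ ⊕ Σ_h`, with `𝔱^⊥` the orthogonal complement of `𝔱` in `𝔰𝔬_h` and `Σ_h` the
symmetric matrices. -/
def InTPerpSym (sp : Submodule ℝ (Matrix (Fin h) (Fin h) ℝ)) (A : Matrix (Fin h) (Fin h) ℝ) :
    Prop :=
  ∃ B S : Matrix (Fin h) (Fin h) ℝ, B.transpose = -B ∧ (∀ C ∈ tAlg sp, matInner B C = 0) ∧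
    S.transpose = S ∧ A = B + S

end Matrices

/-! ### Sub-Riemannian and quaternionic contact structures -/

section SubRiemannian

/-- A step `2` sub-Riemannian structure of rank `h` on `M`. -/
structure SubRiemannian (n h : ℕ) (M : Type*) [TopologicalSpace M]
    [ChartedSpace (EuclideanSpace ℝ (Fin n)) M] [IsManifold (𝓡 n) ∞ M] where
  /-- the horizontal distribution -/
  H : Distribution n M
  /-- the inner product on the horizontal distribution -/
  gH : Π p : M, H p →ₗ[ℝ] H p →ₗ[ℝ] ℝ
  smooth_H : IsSmoothSubbundle h H
  gH_symm : ∀ p x y, gH p x y = gH p y x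
  gH_pos : ∀ p x, x ≠ 0 → 0 < gH p x x
  gH_smooth : ∀ O : Set M, IsOpen O → ∀ X Y : Π q : M, H q,
    SmoothField (toField X) O → SmoothField (toField Y) O →
    SmoothFun (n := n) (fun q ↦ gH q (X q) (Y q)) O
  /-- `[H, H] = TM` at every point -/
  bracket_generating : ∀ p, Submodule.span ℝ
    {v : TangentSpace (𝓡 n) p | ∃ O : Set M, IsOpen O ∧ p ∈ O ∧ ∃ X Y : Π q : M, H q,
      SmoothField (toField X) O ∧ SmoothField (toField Y) O ∧
      v = VectorField.mlieBracket (𝓡 n) (toField X) (toField Y) p} = ⊤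

variable {n h : ℕ} {M : Type*} [TopologicalSpace M]
  [ChartedSpace (EuclideanSpace ℝ (Fin n)) M] [IsManifold (𝓡 n) ∞ M]

namespace SubRiemannian

/-- `e` is a smooth orthonormal frame of `H` over `O`. -/
def IsOrthonormalFrame (S : SubRiemannian n h M) (O : Set M) (e : Fin h → Π q : M, S.H q) : Prop :=
  (∀ i, SmoothField (toField (e i)) O) ∧ ∀ q ∈ O, ∀ i j, S.gH q (e i q) (e j q) = delta i j

/-- `η` is a smooth frame over `O` of the bundle `V^*` of covectors that annihilate `H` (which has
rank three). -/
def IsCoframe (S : SubRiemannian n h M) (O : Set M) (η : Fin 3 → OneForm n M) : Prop :=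
  (∀ a, SmoothForm (η a) O) ∧ ∀ q ∈ O, LinearIndependent ℝ (fun a ↦ η a q) ∧
    ∀ v, v ∈ S.H q ↔ ∀ a, η a q v = 0

/-- The matrix at `q`, in the orthonormal frame `e`, of the endomorphism `J = 𝓙(ξ)` of `H`
given by `⟨J X, Y⟩ = dξ(X, Y)`. -/
def J (S : SubRiemannian n h M) (e : Fin h → Π q : M, S.H q) (ξ : OneForm n M) (q : M) :
    Matrix (Fin h) (Fin h) ℝ :=
  Matrix.of fun j i ↦ dForm ξ (toField (e i)) (toField (e j)) q

/-- The Gram matrix of a coframe for the inner product `⟨ξ, η⟩ = (1 / h) ⟨𝓙(ξ), 𝓙(η)⟩` on `V^*`. -/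
def coGram (S : SubRiemannian n h M) (e : Fin h → Π q : M, S.H q) (η : Fin 3 → OneForm n M)
    (q : M) : Matrix (Fin 3) (Fin 3) ℝ :=
  Matrix.of fun a b ↦ (1 / (h : ℝ)) * matInner (S.J e (η a) q) (S.J e (η b) q)

/-- An orthonormal frame of `H` and a coframe of `V^*` over `O` with
`J₁² = J₂² = J₃² = J₁ J₂ J₃ = -1`. -/
def IsQuaternionicFrame (S : SubRiemannian n h M) (O : Set M) (e : Fin h → Π q : M, S.H q)
    (η : Fin 3 → OneForm n M) : Prop :=
  S.IsOrthonormalFrame O e ∧ S.IsCoframe O η ∧ ∀ q ∈ O,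
    (∀ a, S.J e (η a) q * S.J e (η a) q = -1) ∧
    S.J e (η 0) q * S.J e (η 1) q * S.J e (η 2) q = -1

/-- Quaternionic contact structures. -/
def IsQuaternionicContact (S : SubRiemannian n h M) : Prop :=
  ∀ p, ∃ O : Set M, IsOpen O ∧ p ∈ O ∧ ∃ e η, S.IsQuaternionicFrame O e η

/-- `V` is a (smooth, rank three) complement to `H`. -/
def IsComplement (S : SubRiemannian n h M) (V : Distribution n M) : Prop :=
  IsSmoothSubbundle 3 V ∧ ∀ p, IsCompl (S.H p) (V p)

/-- `U` is the frame of `V` over `O` dual to the coframe `η`. -/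
def IsDualFrame {V : Distribution n M} (O : Set M) (η : Fin 3 → OneForm n M)
    (U : Fin 3 → Π q : M, V q) : Prop :=
  (∀ a, SmoothField (toField (U a)) O) ∧ ∀ q ∈ O, ∀ a b, η a q (U b q) = delta a b

/-- A quaternionic contact structure is integrable if `h > 4`, or if there is a complement with
`dη^a(U_b, X) + dη^b(U_a, X) = 0` for all horizontal `X`. -/
def IsIntegrable (S : SubRiemannian n h M) : Prop :=
  4 < h ∨ ∃ W : Distribution n M, S.IsComplement W ∧
    ∀ O : Set M, IsOpen O → ∀ e η, S.IsQuaternionicFrame O e η →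
    ∀ U : Fin 3 → Π q : M, W q, IsDualFrame O η U →
    ∀ X : Π q : M, S.H q, SmoothField (toField X) O → ∀ p ∈ O, ∀ a b,
      dForm (η a) (toField (U b)) (toField X) p + dForm (η b) (toField (U a)) (toField X) p = 0

/-- Riemannian metrics on `M`. -/
abbrev Metric (n : ℕ) (M : Type*) [TopologicalSpace M]
    [ChartedSpace (EuclideanSpace ℝ (Fin n)) M] [IsManifold (𝓡 n) ∞ M] : Type _ :=
  Bundle.ContMDiffRiemannianMetric (𝓡 n) ∞ (EuclideanSpace ℝ (Fin n))
    (fun p : M ↦ TangentSpace (𝓡 n) p)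

/-- `g` is the canonical Riemannian extension of the sub-Riemannian metric determined by the
complement `V`: `H` and `V` are orthogonal and `V` carries the dual of the inner product of
`V^*`, i.e. the Gram matrices of dual bases of `V^*` and `V` are inverse to each other. -/
structure IsCanonicalExtension (S : SubRiemannian n h M) (V : Distribution n M)
    (g : Metric n M) : Prop where
  horizontal : ∀ p, ∀ x y : S.H p, g.inner p x y = S.gH p x y
  orthogonal : ∀ p, ∀ x ∈ S.H p, ∀ u ∈ V p, g.inner p x u = 0
  vertical : ∀ O : Set M, IsOpen O → ∀ e η, S.IsOrthonormalFrame O e → S.IsCoframe O η →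
    ∀ p ∈ O, ∀ u : Fin 3 → V p, (∀ a b, η a p (u b) = delta a b) →
      (Matrix.of fun a b ↦ g.inner p (u a) (u b)) * S.coGram e η p = 1

/-- The matrix at `p`, in the orthonormal frame `e` of `H`, of the horizontal operator
`X ↦ Tor(u, X)`, for a tangent vector `u`. -/
def torMatrix (S : SubRiemannian n h M) (g : Metric n M) (nabla : Connection n M)
    (e : Fin h → Π q : M, S.H q) (p : M) (u : TangentSpace (𝓡 n) p) :
    Matrix (Fin h) (Fin h) ℝ :=
  Matrix.of fun j i ↦ g.inner p (nabla.torsion p u (e i p)) (e j p)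

/-- `V` and `nabla` are the Biquard complement and the Biquard connection; `g` is the canonical
Riemannian extension of the sub-Riemannian metric determined by `V`. -/
structure IsBiquard (S : SubRiemannian n h M) (V : Distribution n M) (g : Metric n M)
    (nabla : Connection n M) : Prop where
  complement : S.IsComplement V
  extension : S.IsCanonicalExtension V g
  smooth : nabla.ContMDiffCovariantDerivative ∞
  parallel_H : ∀ O : Set M, IsOpen O → ∀ Y : Π q : M, S.H q, SmoothField (toField Y) O →
    ∀ p ∈ O, ∀ v, nabla (toField Y) p v ∈ S.H p
  parallel_V : ∀ O : Set M, IsOpen O → ∀ Y : Π q : M, V q, SmoothField (toField Y) O →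
    ∀ p ∈ O, ∀ v, nabla (toField Y) p v ∈ V p
  parallel_g : ∀ O : Set M, IsOpen O → ∀ X Y : VField n M, SmoothField X O → SmoothField Y O →
    ∀ p ∈ O, ∀ v, dFun (fun q ↦ g.inner q (X q) (Y q)) p v =
      g.inner p (nabla X p v) (Y p) + g.inner p (X p) (nabla Y p v)
  /-- `𝓙` is parallel, `(∇_Z 𝓙)(η^a) = 0`. Here `⟨𝓙(ξ) X, Y⟩ = dξ(X, Y)`, and the covariant
  derivative induced on `V^*` is `∇_Z η^a = - ∑_b η^a(∇_Z U_b) η^b`. -/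
  parallel_J : ∀ O : Set M, IsOpen O → ∀ η, S.IsCoframe O η →
    ∀ U : Fin 3 → Π q : M, V q, IsDualFrame O η U →
    ∀ X Y : Π q : M, S.H q, SmoothField (toField X) O → SmoothField (toField Y) O →
    ∀ Z : VField n M, SmoothField Z O → ∀ p ∈ O, ∀ a,
      dFun (fun q ↦ dForm (η a) (toField X) (toField Y) q) p (Z p) =
        - ∑ b, η a p (nabla (toField (U b)) p (Z p)) * dForm (η b) (toField X) (toField Y) p
        + dForm (η a) (nabla.along Z (toField X)) (toField Y) p
        + dForm (η a) (toField X) (nabla.along Z (toField Y)) p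
  torsion_HH : ∀ p, ∀ x ∈ S.H p, ∀ y ∈ S.H p, nabla.torsion p x y ∈ V p
  torsion_HV : ∀ p, ∀ x ∈ S.H p, ∀ u ∈ V p, nabla.torsion p x u ∈ S.H p
  torsion_V : ∀ O : Set M, IsOpen O → ∀ e η, S.IsOrthonormalFrame O e → S.IsCoframe O η →
    ∀ p ∈ O, ∀ u ∈ V p,
      InTPerpSym (Submodule.span ℝ (Set.range fun a ↦ S.J e (η a) p)) (S.torMatrix g nabla e p u)

end SubRiemannian

/-- The vertical Ricci tensor `Rc^V(A, B) = ∑_e ⟨R(U_e, A) B, U_e⟩` at `p`, for a vertical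
orthonormal frame `U`. -/
def verticalRicci (g : SubRiemannian.Metric n M) (nabla : Connection n M)
    (U : Fin 3 → VField n M) (A B : VField n M) (p : M) : ℝ :=
  ∑ d, g.inner p (nabla.curvature (U d) A B p) (U d p)

/-- The vertical torsion function `τ = -η^3(Tor(U_1, U_2))`. -/
def verticalTorsion (nabla : Connection n M) (η : Fin 3 → OneForm n M) (U : Fin 3 → VField n M)
    (q : M) : ℝ :=
  - η 2 q (nabla.torsion q (U 0 q) (U 1 q))

end SubRiemannian

end QC

end

/-! Involutivity of `V` makes `Tor(U_a, U_b)` vertical. In that case, for indices with `J_a J_b J_c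
= -1`, the skew-symmetric term and the derivative term of the formula are both zero, so the formula
amounts to `Rc^V(U_a, U_b) = -(4/h) ⟨T_a^Σ, T_b^Σ⟩`. Write `R^H`, `R^V` for the curvature matrices
of the two bundles and `t_abc = g(Tor(U_a, U_b), U_c)`.

Constraints on the torsion. The first Bianchi identity on two horizontal vectors and one vertical
vector expresses `R^V(e_i, e_j)` through `J_b T_a + T_aᵀ J_b + ∑ t_cab J_c`
(`curvFrame_horizontal`). As `R^V` is skew-symmetric, the symmetrization of this expression in `a,
b` is zero. Since `tr(J_c T_a) = 0`, pairing with the `J_c` shows that `t` is totally antisymmetric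
(`antisymm_of_constraint`), whence `J_b T_a + T_aᵀ J_b + J_a T_b + T_bᵀ J_a = 0`. Splitting by
commutation with the `J`'s, together with `A = ∑ J_d A J_d` for the skew parts `A`, which expresses
orthogonality to `𝔱`, gives `⟨T_a^o, T_b^o⟩ = 0` and `tr(J_a [T_a, T_c]) = 2 ⟨T_a^Σ, T_b^Σ⟩`
(`trace_torsion`).

Vertical curvature. Because `𝓙` is parallel, `[J_a, R^H] = ∑ R^V_ab J_b` (`commutator_curvature`),
so `R^V` is recovered from the traces `tr(J_d R^H)` (`curvFrame_U_eq`). The first Bianchi identity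
on two vertical vectors and one horizontal vector computes `R^H(U_c, U_a)` (`curvFrame_vertical`);
in the trace against `J_b` only the commutator `[T_a, T_c]` survives, as `tr(J_b T_d)` and its
covariant derivative are zero (`trace_J_curvFrame`).

Together, `R^V(U_c, U_a)_cb` and `R^V(U_c, U_b)_ca` both equal `-(4/h) ⟨T_a^Σ, T_b^Σ⟩`. The former
is the Ricci component. By the Bianchi identity on three vertical vectors (`vertical_bianchi`) the
difference of the two is the derivative of `t_abc = -τ` along `U_c`, which is therefore zero. -/

noncomputable section

namespace QC

/-! ### Calculus of fields and functions that are smooth on an open set only. -/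

section Calculus

set_option linter.unusedSectionVars false

open VectorField

variable {n : ℕ} {M : Type*} [TopologicalSpace M] [ChartedSpace (EuclideanSpace ℝ (Fin n)) M]
  [IsManifold (𝓡 n) ∞ M] {O : Set M} {p : M}

theorem SmoothField.contMDiffAt {X : VField n M} (hX : SmoothField X O) (hO : IsOpen O)
    (hp : p ∈ O) : ContMDiffAt (𝓡 n) ((𝓡 n).prod 𝓘(ℝ, EuclideanSpace ℝ (Fin n))) ∞
      (fun q ↦ (⟨q, X q⟩ : TangentBundle (𝓡 n) M)) p :=
  (hX p hp).contMDiffAt (hO.mem_nhds hp)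

theorem SmoothField.mdifferentiableAt {X : VField n M} (hX : SmoothField X O) (hO : IsOpen O)
    (hp : p ∈ O) : MDifferentiableAt (𝓡 n) ((𝓡 n).prod 𝓘(ℝ, EuclideanSpace ℝ (Fin n)))
      (fun q ↦ (⟨q, X q⟩ : TangentBundle (𝓡 n) M)) p :=
  (hX.contMDiffAt hO hp).mdifferentiableAt (by simp)

theorem SmoothFun.mdifferentiableAt {f : M → ℝ} (hf : SmoothFun (n := n) f O) (hO : IsOpen O)
    (hp : p ∈ O) : MDifferentiableAt (𝓡 n) 𝓘(ℝ, ℝ) f p :=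
  ((hf p hp).contMDiffAt (hO.mem_nhds hp)).mdifferentiableAt (by simp)

theorem SmoothField.congr {X Y : VField n M} (hX : SmoothField X O) (h : ∀ q ∈ O, Y q = X q) :
    SmoothField Y O :=
  ContMDiffOn.congr hX fun q hq ↦ by simp [h q hq]

theorem SmoothField.mono {X : VField n M} {O' : Set M} (hX : SmoothField X O) (h : O' ⊆ O) :
    SmoothField X O' :=
  ContMDiffOn.mono hX h

theorem SmoothFun.congr {f f' : M → ℝ} (hf : SmoothFun (n := n) f O) (h : ∀ q ∈ O, f' q = f q) :
    SmoothFun (n := n) f' O :=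
  ContMDiffOn.congr hf h

theorem SmoothField.add {X Y : VField n M} (hX : SmoothField X O) (hY : SmoothField Y O) :
    SmoothField (X + Y) O :=
  ContMDiffOn.add_section hX hY

theorem SmoothField.sub {X Y : VField n M} (hX : SmoothField X O) (hY : SmoothField Y O) :
    SmoothField (X - Y) O :=
  ContMDiffOn.sub_section hX hY

theorem SmoothField.smul {f : M → ℝ} {X : VField n M} (hf : SmoothFun (n := n) f O)
    (hX : SmoothField X O) : SmoothField (f • X) O :=
  ContMDiffOn.smul_section hf hX

theorem SmoothField.sum {ι : Type*} {s : Finset ι} {X : ι → VField n M}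
    (hX : ∀ i ∈ s, SmoothField (X i) O) : SmoothField (fun q ↦ ∑ i ∈ s, X i q) O :=
  ContMDiffOn.sum_section hX

theorem SmoothField.mlieBracket {X Y : VField n M} (hO : IsOpen O) (hX : SmoothField X O)
    (hY : SmoothField Y O) : SmoothField (mlieBracket (𝓡 n) X Y) O := fun _ hq ↦ by
  have : IsManifold (𝓡 n) (minSmoothness ℝ 2) M := by
    rw [minSmoothness_of_isRCLikeNormedField]; infer_instance
  have : IsManifold (𝓡 n) (((⊤ : ℕ∞) : ℕ∞ω) + 1) M := inferInstanceAs (IsManifold (𝓡 n) ∞ M)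
  have : IsManifold (𝓡 n) (minSmoothness ℝ 3) M := by
    rw [minSmoothness_of_isRCLikeNormedField]; infer_instance
  exact (ContMDiffAt.mlieBracket_vectorField (m := ⊤) (n := ⊤) (hX.contMDiffAt hO hq)
    (hY.contMDiffAt hO hq)
    (by rw [minSmoothness_of_isRCLikeNormedField]; rfl)).contMDiffWithinAt

theorem Connection.congr (nabla : Connection n M) (hO : IsOpen O) {Y Y' : VField n M}
    (hY : SmoothField Y O) (h : ∀ q ∈ O, Y q = Y' q) (hp : p ∈ O) : nabla Y p = nabla Y' p :=
  nabla.isCovariantDerivativeOnUniv.congr_of_eventuallyEq (hY.mdifferentiableAt hO hp)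
    ((hY.congr fun q hq ↦ (h q hq).symm).mdifferentiableAt hO hp) Filter.univ_mem
    (Filter.eventually_of_mem (hO.mem_nhds hp) h)

/-- Regularity of a connection is phrased for globally smooth fields, whereas frames are smooth on
`O` only; a cutoff bridges the two. -/
theorem SmoothField.along [T2Space M] {nabla : Connection n M}
    (hn : nabla.ContMDiffCovariantDerivative ∞) (hO : IsOpen O) {X Y : VField n M}
    (hX : SmoothField X O) (hY : SmoothField Y O) : SmoothField (nabla.along X Y) O := by
  intro p hp
  -- The bump function is supported in `O` and equals one near `p`, so `ψ • Y` is globally smooth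
  -- and has the same covariant derivative as `Y` near `p`.
  obtain ⟨ψ, -, hψ⟩ := (SmoothBumpFunction.nhds_basis_tsupport (I := 𝓡 n) p).mem_iff.1
    (hO.mem_nhds hp)
  obtain ⟨O', hO'sub, hO', hpO'⟩ := mem_nhds_iff.1 ψ.eventuallyEq_one
  have hglob : SmoothField ((ψ : M → ℝ) • Y) Set.univ := contMDiffOn_univ.2
    (ContMDiffOn.smul_section_of_tsupport (ψ.contMDiff.contMDiffOn (s := O)) hO hψ hY)
  have h1 := hn.contMDiff.contMDiff (σ := (ψ : M → ℝ) • Y) hglob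
  have h2 := ContMDiffOn.clm_bundle_apply (h1.mono (Set.subset_univ (O ∩ O')))
    (hX.mono Set.inter_subset_left)
  have h3 : SmoothField (nabla.along X Y) (O ∩ O') := by
    refine SmoothField.congr h2 fun q hq ↦ ?_
    have := nabla.congr (hO.inter hO') (hY.mono Set.inter_subset_left)
      (Y' := (ψ : M → ℝ) • Y) (fun q hq ↦ ?_) hq
    · exact congrArg (fun L ↦ L (X q)) this
    · have := hO'sub hq.2
      simp only [Set.mem_ofPred_eq, Pi.one_apply] at this
      simp [this]
  exact (h3.contMDiffAt (hO.inter hO') ⟨hp, hpO'⟩).contMDiffWithinAt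

theorem SmoothFun.inner {g : SubRiemannian.Metric n M} {X Y : VField n M}
    (hX : SmoothField X O) (hY : SmoothField Y O) :
    SmoothFun (n := n) (fun q ↦ g.inner q (X q) (Y q)) O := by
  have h := ContMDiffOn.clm_bundle_apply₂ (F₁ := EuclideanSpace ℝ (Fin n))
    (F₂ := EuclideanSpace ℝ (Fin n)) (F₃ := ℝ) (E₃ := Bundle.Trivial M ℝ)
    (g.contMDiff.contMDiffOn (s := O)) hX hY
  intro q hq
  have := h q hq
  rw [Bundle.contMDiffWithinAt_section] at this
  exact this

theorem dFun_congr {f f' : M → ℝ} (hO : IsOpen O) (hp : p ∈ O) (h : ∀ q ∈ O, f q = f' q) :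
    dFun (n := n) f p = dFun (n := n) f' p := by
  have hff : f =ᶠ[nhds p] f' := Filter.eventually_of_mem (hO.mem_nhds hp) h
  ext v
  have := hff.mfderiv_eq (I := 𝓡 n) (I' := 𝓘(ℝ, ℝ))
  exact congrArg (fun L : EuclideanSpace ℝ (Fin n) →L[ℝ] ℝ ↦ L v) this

theorem dFun_eq_zero {f : M → ℝ} {c : ℝ} (hO : IsOpen O) (hp : p ∈ O) (h : ∀ q ∈ O, f q = c) :
    dFun (n := n) f p = 0 := by
  rw [dFun_congr (f' := fun _ ↦ c) hO hp h, dFun, mvfderiv_const]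

theorem dFun_mul {f f' : M → ℝ} (hO : IsOpen O) (hp : p ∈ O) (hf : SmoothFun (n := n) f O)
    (hf' : SmoothFun (n := n) f' O) (v : TangentSpace (𝓡 n) p) :
    dFun (fun q ↦ f q * f' q) p v = dFun f p v * f' p + f p * dFun f' p v := by
  have := congrArg (fun L ↦ L v)
    (mvfderiv_fun_mul (hf.mdifferentiableAt hO hp) (hf'.mdifferentiableAt hO hp))
  exact this.trans (by simp [dFun]; ring)

theorem dFun_add {f f' : M → ℝ} (hO : IsOpen O) (hp : p ∈ O) (hf : SmoothFun (n := n) f O)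
    (hf' : SmoothFun (n := n) f' O) (v : TangentSpace (𝓡 n) p) :
    dFun (fun q ↦ f q + f' q) p v = dFun f p v + dFun f' p v := by
  exact congrArg (fun L ↦ L v)
    (mvfderiv_fun_add (hf.mdifferentiableAt hO hp) (hf'.mdifferentiableAt hO hp))

theorem dFun_neg {f : M → ℝ} (v : TangentSpace (𝓡 n) p) :
    dFun (fun q ↦ -f q) p v = -dFun f p v := by
  simp [dFun, mvfderiv_fun_neg]

theorem dFun_sub {f f' : M → ℝ} (hO : IsOpen O) (hp : p ∈ O) (hf : SmoothFun (n := n) f O)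
    (hf' : SmoothFun (n := n) f' O) (v : TangentSpace (𝓡 n) p) :
    dFun (fun q ↦ f q - f' q) p v = dFun f p v - dFun f' p v := by
  exact congrArg (fun L ↦ L v)
    (mvfderiv_fun_sub (hf.mdifferentiableAt hO hp) (hf'.mdifferentiableAt hO hp))

theorem SmoothFun.mul {f f' : M → ℝ} (hf : SmoothFun (n := n) f O)
    (hf' : SmoothFun (n := n) f' O) : SmoothFun (n := n) (fun q ↦ f q * f' q) O :=
  ContMDiffOn.mul hf hf'

theorem SmoothFun.neg {f : M → ℝ} (hf : SmoothFun (n := n) f O) :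
    SmoothFun (n := n) (fun q ↦ -f q) O :=
  ContMDiffOn.neg hf

theorem SmoothFun.sum {ι : Type*} {s : Finset ι} {f : ι → M → ℝ}
    (hf : ∀ i ∈ s, SmoothFun (n := n) (f i) O) : SmoothFun (n := n) (fun q ↦ ∑ i ∈ s, f i q) O :=
  contMDiffOn_finsetSum hf

theorem dFun_sum {ι : Type*} (s : Finset ι) {f : ι → M → ℝ} (hO : IsOpen O) (hp : p ∈ O)
    (hf : ∀ i ∈ s, SmoothFun (n := n) (f i) O) (v : TangentSpace (𝓡 n) p) :
    dFun (fun q ↦ ∑ i ∈ s, f i q) p v = ∑ i ∈ s, dFun (f i) p v := by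
  classical
  induction s using Finset.induction_on with
  | empty => simp [dFun, mvfderiv_const]
  | insert a s ha ih =>
    simp only [Finset.sum_insert ha]
    rw [dFun_add hO hp (hf a (by simp)) (SmoothFun.sum fun i hi ↦ hf i (by simp [hi])),
      ih fun i hi ↦ hf i (by simp [hi])]

/-- The derivative of a smooth function along a smooth field is smooth. -/
theorem SmoothFun.dFun {f : M → ℝ} {X : VField n M} (hO : IsOpen O)
    (hf : SmoothFun (n := n) f O) (hX : SmoothField X O) :
    SmoothFun (n := n) (fun q ↦ dFun f q (X q)) O := by
  have h := ContMDiffOn.contMDiffOn_tangentMapWithin (m := ∞) hf (by rfl) hO.uniqueMDiffOn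
  have h2 := (contMDiff_snd_tangentBundle_modelSpace ℝ 𝓘(ℝ, ℝ) (n := ∞)).comp_contMDiffOn
    (h.comp hX fun q hq ↦ hq)
  refine h2.congr fun q hq ↦ ?_
  simp only [Function.comp, tangentMapWithin, mfderivWithin_of_isOpen hO hq]
  rfl

theorem jacobi {X Y Z : VField n M} (hO : IsOpen O) (hp : p ∈ O) (hX : SmoothField X O)
    (hY : SmoothField Y O) (hZ : SmoothField Z O) :
    VectorField.mlieBracket (𝓡 n) X (VectorField.mlieBracket (𝓡 n) Y Z) p =
      VectorField.mlieBracket (𝓡 n) (VectorField.mlieBracket (𝓡 n) X Y) Z p +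
        VectorField.mlieBracket (𝓡 n) Y (VectorField.mlieBracket (𝓡 n) X Z) p := by
  have : IsManifold (𝓡 n) (minSmoothness ℝ 3) M := by
    rw [minSmoothness_of_isRCLikeNormedField]; infer_instance
  have h2 : minSmoothness ℝ 2 ≤ (∞ : ℕ∞ω) := by
    rw [minSmoothness_of_isRCLikeNormedField]; exact WithTop.coe_le_coe.2 (le_top : (2 : ℕ∞) ≤ ⊤)
  exact leibniz_identity_mlieBracket_apply ((hX.contMDiffAt hO hp).of_le h2)
    ((hY.contMDiffAt hO hp).of_le h2) ((hZ.contMDiffAt hO hp).of_le h2)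

end Calculus

/-! ### Leibniz rules for a connection and the first Bianchi identity with torsion. -/

section Connections

open VectorField

set_option linter.unusedSectionVars false

variable {n : ℕ} {M : Type*} [TopologicalSpace M] [ChartedSpace (EuclideanSpace ℝ (Fin n)) M]
  [IsManifold (𝓡 n) ∞ M] {O : Set M} {p : M} {nabla : Connection n M}

theorem Connection.add_apply (hO : IsOpen O) (hp : p ∈ O) {X Y : VField n M}
    (hX : SmoothField X O) (hY : SmoothField Y O) (v : TangentSpace (𝓡 n) p) :
    nabla (X + Y) p v = nabla X p v + nabla Y p v := by
  rw [nabla.isCovariantDerivativeOnUniv.add (hX.mdifferentiableAt hO hp)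
    (hY.mdifferentiableAt hO hp)]
  rfl

theorem Connection.smul_apply (hO : IsOpen O) (hp : p ∈ O) {f : M → ℝ} {Y : VField n M}
    (hf : SmoothFun (n := n) f O) (hY : SmoothField Y O) (v : TangentSpace (𝓡 n) p) :
    nabla (f • Y) p v = f p • nabla Y p v + dFun f p v • Y p := by
  rw [nabla.isCovariantDerivativeOnUniv.leibniz (hY.mdifferentiableAt hO hp)
    (hf.mdifferentiableAt hO hp)]
  rfl

theorem Connection.sub_apply (hO : IsOpen O) (hp : p ∈ O) {X Y : VField n M}
    (hX : SmoothField X O) (hY : SmoothField Y O) (v : TangentSpace (𝓡 n) p) :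
    nabla (X - Y) p v = nabla X p v - nabla Y p v := by
  have h := Connection.add_apply (nabla := nabla) hO hp (hX.sub hY) hY v
  rw [sub_add_cancel] at h
  rw [h, add_sub_cancel_right]

theorem Connection.sum_smul_apply (hO : IsOpen O) (hp : p ∈ O) {ι : Type*} (s : Finset ι)
    {f : ι → M → ℝ} {Y : ι → VField n M} (hf : ∀ i ∈ s, SmoothFun (n := n) (f i) O)
    (hY : ∀ i ∈ s, SmoothField (Y i) O) (v : TangentSpace (𝓡 n) p) :
    nabla (fun q ↦ ∑ i ∈ s, f i q • Y i q) p v =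
      ∑ i ∈ s, (f i p • nabla (Y i) p v + dFun (f i) p v • Y i p) := by
  classical
  induction s using Finset.induction_on with
  | empty =>
    simp only [Finset.sum_empty]
    have h : nabla (0 : VField n M) = 0 := nabla.zero
    exact congrArg (fun L : Π q : M, TangentSpace (𝓡 n) q →L[ℝ] TangentSpace (𝓡 n) q ↦ L p v) h
  | insert a s ha ih =>
    have h : (fun q ↦ ∑ i ∈ insert a s, f i q • Y i q) =
        f a • Y a + fun q ↦ ∑ i ∈ s, f i q • Y i q := by
      funext q; simp [Finset.sum_insert ha]
    have hs : SmoothField (fun q ↦ ∑ i ∈ s, f i q • Y i q) O :=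
      SmoothField.sum (X := fun i ↦ f i • Y i) fun i hi ↦
        .smul (hf i (by simp [hi])) (hY i (by simp [hi]))
    rw [h, Connection.add_apply hO hp (.smul (hf a (by simp)) (hY a (by simp))) hs,
      Connection.smul_apply hO hp (hf a (by simp)) (hY a (by simp)),
      ih (fun i hi ↦ hf i (by simp [hi])) fun i hi ↦ hY i (by simp [hi]), Finset.sum_insert ha]

/-- Derivatives along fields commute up to the derivative along the Lie bracket. -/
theorem dFun_mlieBracket (hO : IsOpen O) (hp : p ∈ O) {f : M → ℝ} {X Y Z : VField n M}
    (hf : SmoothFun (n := n) f O) (hX : SmoothField X O) (hY : SmoothField Y O)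
    (hZ : SmoothField Z O) (hZp : Z p ≠ 0) :
    dFun f p (mlieBracket (𝓡 n) X Y p) =
      dFun (fun q ↦ dFun f q (Y q)) p (X p) - dFun (fun q ↦ dFun f q (X q)) p (Y p) := by
  have smulr : ∀ {f : M → ℝ} {X Z : VField n M} {q : M}, q ∈ O → SmoothFun (n := n) f O →
      SmoothField Z O → mlieBracket (𝓡 n) X (f • Z) q =
        dFun f q (X q) • Z q + f q • mlieBracket (𝓡 n) X Z q := fun hq hf hZ ↦
    mlieBracket_smul_right (hf.mdifferentiableAt hO hq) (hZ.mdifferentiableAt hO hq)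
  have addr : ∀ {X Y Z : VField n M}, SmoothField Y O → SmoothField Z O →
      mlieBracket (𝓡 n) X (Y + Z) p = mlieBracket (𝓡 n) X Y p + mlieBracket (𝓡 n) X Z p :=
    fun hY hZ ↦ mlieBracket_add_right (hY.mdifferentiableAt hO hp) (hZ.mdifferentiableAt hO hp)
  have congr : ∀ {X Y Y' : VField n M}, (∀ q ∈ O, Y q = Y' q) →
      mlieBracket (𝓡 n) X Y p = mlieBracket (𝓡 n) X Y' p := fun h ↦
    Filter.EventuallyEq.mlieBracket_vectorField_eq Filter.EventuallyEq.rfl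
      (Filter.eventually_of_mem (hO.mem_nhds hp) h)
  have key : ∀ {X Y : VField n M}, SmoothField X O → SmoothField Y O →
      mlieBracket (𝓡 n) X (mlieBracket (𝓡 n) Y (f • Z)) p =
        dFun (fun q ↦ dFun f q (Y q)) p (X p) • Z p + dFun f p (Y p) • mlieBracket (𝓡 n) X Z p
        + (dFun f p (X p) • mlieBracket (𝓡 n) Y Z p
          + f p • mlieBracket (𝓡 n) X (mlieBracket (𝓡 n) Y Z) p) := by
    intro X Y hX hY
    have hYf := hf.dFun hO hY
    rw [congr (Y' := (fun q ↦ dFun f q (Y q)) • Z + f • mlieBracket (𝓡 n) Y Z)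
      fun q hq ↦ smulr hq hf hZ, addr (.smul hYf hZ) (.smul hf (hY.mlieBracket hO hZ)),
      smulr hp hYf hZ, smulr hp hf (hY.mlieBracket hO hZ)]
  -- The Jacobi identity for `X`, `Y`, `f Z` minus `f` times the one for `X`, `Y`, `Z` leaves a
  -- multiple of `Z` whose coefficient is the claimed identity; this is why a field with `Z p ≠ 0`
  -- is needed.
  have h := jacobi hO hp hX hY (.smul hf hZ)
  rw [key hX hY, key hY hX, smulr hp hf hZ, jacobi hO hp hX hY hZ] at h
  have h' : (dFun f p (mlieBracket (𝓡 n) X Y p) - (dFun (fun q ↦ dFun f q (Y q)) p (X p)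
      - dFun (fun q ↦ dFun f q (X q)) p (Y p))) • Z p = 0 := by
    rw [← sub_eq_zero] at h
    rw [← neg_eq_zero, ← h]
    module
  exact sub_eq_zero.1 ((smul_eq_zero.1 h').resolve_right hZp)

theorem Connection.torsion_eq (hO : IsOpen O) (hp : p ∈ O) {X Y : VField n M}
    (hX : SmoothField X O) (hY : SmoothField Y O) :
    nabla.torsion p (X p) (Y p) =
      nabla.along X Y p - nabla.along Y X p - mlieBracket (𝓡 n) X Y p :=
  nabla.torsion_apply (hX.mdifferentiableAt hO hp) (hY.mdifferentiableAt hO hp)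

/-- The vector field `Tor(X, Y)`. -/
def Connection.torField (nabla : Connection n M) (X Y : VField n M) : VField n M :=
  fun q ↦ nabla.torsion q (X q) (Y q)

theorem Connection.torField_eqOn (hO : IsOpen O) {X Y : VField n M}
    (hX : SmoothField X O) (hY : SmoothField Y O) : ∀ q ∈ O, nabla.torField X Y q =
      (nabla.along X Y - nabla.along Y X - mlieBracket (𝓡 n) X Y) q := fun _ hq ↦
  Connection.torsion_eq hO hq hX hY

theorem SmoothField.torField [T2Space M] (hn : nabla.ContMDiffCovariantDerivative ∞)
    (hO : IsOpen O) {X Y : VField n M} (hX : SmoothField X O) (hY : SmoothField Y O) :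
    SmoothField (nabla.torField X Y) O :=
  SmoothField.congr (((hX.along hn hO hY).sub (hY.along hn hO hX)).sub (hX.mlieBracket hO hY))
    (Connection.torField_eqOn hO hX hY)

/-- The first Bianchi identity for a connection with torsion. -/
theorem Connection.first_bianchi [T2Space M] (hn : nabla.ContMDiffCovariantDerivative ∞)
    (hO : IsOpen O) (hp : p ∈ O) {X Y Z : VField n M} (hX : SmoothField X O)
    (hY : SmoothField Y O) (hZ : SmoothField Z O) :
    nabla.curvature X Y Z p + nabla.curvature Y Z X p + nabla.curvature Z X Y p =
      nabla (nabla.torField Y Z) p (X p) + nabla (nabla.torField Z X) p (Y p)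
        + nabla (nabla.torField X Y) p (Z p)
        + nabla.torsion p (X p) (mlieBracket (𝓡 n) Y Z p)
        + nabla.torsion p (Y p) (mlieBracket (𝓡 n) Z X p)
        + nabla.torsion p (Z p) (mlieBracket (𝓡 n) X Y p) := by
  -- One cyclic summand of the right-hand side, with both torsions expanded. The cyclic sum gives
  -- the curvatures and the double brackets, which cancel by Jacobi.
  have key : ∀ {X Y Z : VField n M}, SmoothField X O → SmoothField Y O → SmoothField Z O →
      nabla (nabla.torField Y Z) p (X p) + nabla.torsion p (X p) (mlieBracket (𝓡 n) Y Z p) =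
        nabla (nabla.along Y Z) p (X p) - nabla (nabla.along Z Y) p (X p)
        - nabla X p (mlieBracket (𝓡 n) Y Z p) - mlieBracket (𝓡 n) X (mlieBracket (𝓡 n) Y Z) p := by
    intro X Y Z hX hY hZ
    have hYZ := hY.along hn hO hZ
    have hZY := hZ.along hn hO hY
    have hb := hY.mlieBracket hO hZ
    rw [nabla.congr hO (hY.torField hn hO hZ) (Connection.torField_eqOn hO hY hZ) hp,
      Connection.sub_apply hO hp (hYZ.sub hZY) hb, Connection.sub_apply hO hp hYZ hZY,
      Connection.torsion_eq hO hp hX hb]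
    simp only [Connection.along]
    abel
  have hjac : mlieBracket (𝓡 n) X (mlieBracket (𝓡 n) Y Z) p
      + mlieBracket (𝓡 n) Y (mlieBracket (𝓡 n) Z X) p
      + mlieBracket (𝓡 n) Z (mlieBracket (𝓡 n) X Y) p = 0 := by
    rw [jacobi hO hp hX hY hZ, mlieBracket_swap (V := X) (W := Z),
      mlieBracket_swap_apply (V := mlieBracket (𝓡 n) X Y)]
    have : mlieBracket (𝓡 n) Y (-mlieBracket (𝓡 n) Z X) p =
        -mlieBracket (𝓡 n) Y (mlieBracket (𝓡 n) Z X) p := by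
      have := mlieBracket_const_smul_right (I := 𝓡 n) (V := Y) (c := (-1 : ℝ))
        ((hZ.mlieBracket hO hX).mdifferentiableAt hO hp)
      simpa using this
    rw [this]; abel
  have h1 := key hX hY hZ
  have h2 := key hY hZ hX
  have h3 := key hZ hX hY
  have e : ∀ A B C D E F : TangentSpace (𝓡 n) p, A + B + C + D + E + F =
    (A + D) + (B + E) + (C + F) := fun _ _ _ _ _ _ ↦ by abel
  rw [e, h1, h2, h3]
  simp only [Connection.curvature, Pi.sub_apply]
  have e2 : ∀ A B C x y z : TangentSpace (𝓡 n) p, x + y + z = 0 → A + B + C = (A - x) + (B - y) + (C - z) := by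
    intro A B C x y z h
    have : (A - x) + (B - y) + (C - z) = A + B + C - (x + y + z) := by abel
    rw [this, h, sub_zero]
  rw [← e2 _ _ _ _ _ _ hjac]
  simp only [Connection.along]
  abel

end Connections

/-! ### Quaternion relations in a ring. -/

section QuaternionicAlgebra

/-- The multiplication table of the imaginary quaternions. -/
structure IsQuaternionTriple {R : Type*} [Ring R] (I J K : R) : Prop where
  II : I * I = -1
  JJ : J * J = -1
  KK : K * K = -1
  IJ : I * J = K
  JK : J * K = I
  KI : K * I = J
  JI : J * I = -K
  KJ : K * J = -I
  IK : I * K = -J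

variable {R : Type*} [Ring R] {I J K : R}

theorem IsQuaternionTriple.rotate (h : IsQuaternionTriple I J K) : IsQuaternionTriple J K I :=
  ⟨h.JJ, h.KK, h.II, h.JK, h.KI, h.IJ, h.KJ, h.IK, h.JI⟩

/-- Exchanging two units reverses the orientation, which the sign of `K` restores. -/
theorem IsQuaternionTriple.swap (h : IsQuaternionTriple I J K) : IsQuaternionTriple J I (-K) :=
  ⟨h.JJ, h.II, by simp [h.KK], h.JI, by simp [h.IK], by simp [h.KJ], by simp [h.IJ],
    by simp [h.KI], by simp [h.JK]⟩

theorem IsQuaternionTriple.of_mul_eq (hI : I * I = -1) (hJ : J * J = -1) (hK : K * K = -1)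
    (hIJK : I * J * K = -1) : IsQuaternionTriple I J K := by
  have hIJ : I * J = K := by
    have := congrArg (· * K) hIJK
    simp only [mul_assoc, hK] at this
    simpa using this
  have hJK : J * K = I := by
    have := congrArg (I * ·) hIJK
    simp only [← mul_assoc, hI] at this
    simpa using this
  have hKJ : K * J = -I := by rw [← hIJ, mul_assoc, hJ]; simp
  have hIK : I * K = -J := by rw [← hIJ, ← mul_assoc, hI]; simp
  have hKI : K * I = J := by
    have := congrArg (K * ·) hJK
    simp only [← mul_assoc, hKJ] at this
    rw [← this, neg_mul, hIK, neg_neg]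
  refine ⟨hI, hJ, hK, hIJ, hJK, hKI, ?_, hKJ, hIK⟩
  rw [← hJK, ← mul_assoc, hJ]; simp

end QuaternionicAlgebra

/-! ### Linear algebra of the torsion constraints. -/

section Constraint

open Matrix

variable {h : ℕ} {I J K S₁ S₂ S₃ A₁ A₂ : Matrix (Fin h) (Fin h) ℝ}

/-- Commuting and anticommuting with the invertible `I` are the two eigenspaces of conjugation by
`I`, and these are independent. -/
theorem eq_zero_of_commute_of_anticommute {I X Y : Matrix (Fin h) (Fin h) ℝ} (hI : I * I = -1)
    (hX : I * X = X * I) (hY : I * Y = -(Y * I)) (hXY : X + Y = 0) : X = 0 ∧ Y = 0 := by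
  have hYX : Y = -X := by rw [← sub_eq_zero, sub_neg_eq_add, add_comm, hXY]
  have h1 : I * X = 0 := by
    have : I * X + I * X = 0 := by
      rw [hYX] at hY
      simp only [mul_neg, neg_mul, neg_neg, ← hX] at hY
      nth_rewrite 1 [← hY]; simp
    have h2 : (2 : ℝ) • (I * X) = 0 := by rw [two_smul, this]
    exact (smul_eq_zero.1 h2).resolve_left two_ne_zero
  have h0 : X = 0 := by
    have := congrArg (I * ·) h1
    simp only [← mul_assoc, hI] at this
    simpa using this
  exact ⟨h0, by rw [hYX, h0, neg_zero]⟩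

/-- As `I² = -1`, the anticommutator `I S + S I` commutes with `I` and the commutator `I A - A I`
anticommutes with it, so each vanishes separately. -/
theorem diagonal_constraint {I S A : Matrix (Fin h) (Fin h) ℝ} (hI : I * I = -1)
    (hD : I * S + S * I + (I * A - A * I) = 0) : S * I = -(I * S) ∧ A * I = I * A := by
  obtain ⟨h1, h2⟩ := eq_zero_of_commute_of_anticommute (I := I) (X := I * S + S * I)
    (Y := I * A - A * I) hI
    (by simp only [mul_add, add_mul, mul_assoc, hI]; simp only [← mul_assoc, hI]; noncomm_ring)
    (by simp only [mul_sub, sub_mul, mul_assoc, hI]; simp only [← mul_assoc, hI]; noncomm_ring)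
    hD
  exact ⟨eq_neg_of_add_eq_zero_right h1, (sub_eq_zero.1 h2).symm⟩

/-- Commutation with `I` gives `I A I = -A` and `K A K = J A J`, so `hP` collapses to `A = J A J`.
-/
theorem anticommute_of_proj_eq_zero (hq : IsQuaternionTriple I J K)
    {A : Matrix (Fin h) (Fin h) ℝ} (hA : A * I = I * A)
    (hP : A = I * A * I + J * A * J + K * A * K) : A * J = -(J * A) := by
  have h1 : I * A * I = -A := by rw [mul_assoc, hA, ← mul_assoc, hq.II]; simp
  have h2 : K * A * K = J * A * J := by
    rw [← hq.IJ]
    calc I * J * A * (I * J) = -(J * I) * A * (I * J) := by rw [hq.IJ, hq.JI, neg_neg]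
      _ = -(J * (I * A * I) * J) := by noncomm_ring
      _ = J * A * J := by rw [h1]; noncomm_ring
  rw [h1, h2] at hP
  have h3 : (2 : ℝ) • A = (2 : ℝ) • (J * A * J) := by
    rw [two_smul, two_smul]; nth_rewrite 1 [hP]; abel
  have h4 : A = J * A * J := smul_right_injective _ (two_ne_zero' ℝ) h3
  have h5 := congrArg (J * ·) h4
  simp only [← mul_assoc, hq.JJ] at h5
  rw [h5]; simp

/-- The off-diagonal constraint splits into its symmetric and skew-symmetric contributions. -/
theorem offdiagonal_constraint (hq : IsQuaternionTriple I J K)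
    (h1 : S₁ * I = -(I * S₁)) (hA1 : A₁ * I = I * A₁) (hA1J : A₁ * J = -(J * A₁))
    (hA2I : A₂ * I = -(I * A₂))
    (hD : J * S₁ + S₁ * J + (J * A₁ - A₁ * J) + (I * S₂ + S₂ * I + (I * A₂ - A₂ * I)) = 0) :
    J * S₁ + S₁ * J + (I * S₂ + S₂ * I) = 0 ∧ J * A₁ + I * A₂ = 0 := by
  have e : J * S₁ + S₁ * J + (I * S₂ + S₂ * I) + (J * A₁ - A₁ * J + (I * A₂ - A₂ * I)) = 0 := by
    rw [← hD]; abel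
  have hJI : J * I = -(I * J) := by rw [hq.JI, hq.IJ]
  -- The same splitting by conjugation with `I`: the symmetric contribution commutes with `I`, and
  -- the skew-symmetric one anticommutes.
  have hX : I * (J * S₁ + S₁ * J + (I * S₂ + S₂ * I)) =
      (J * S₁ + S₁ * J + (I * S₂ + S₂ * I)) * I := by
    have e1 : I * (J * S₁) = J * S₁ * I := by
      rw [mul_assoc, h1, mul_neg, ← mul_assoc, ← mul_assoc, hJI]; simp
    have e2 : I * (S₁ * J) = S₁ * J * I := by
      rw [mul_assoc, hJI, mul_neg, ← mul_assoc, ← mul_assoc, h1]; simp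
    simp only [mul_add, add_mul, e1, e2]
    simp only [← mul_assoc, hq.II]
    simp only [mul_assoc, hq.II]
    noncomm_ring
  have hY : I * (J * A₁ - A₁ * J + (I * A₂ - A₂ * I)) =
      -((J * A₁ - A₁ * J + (I * A₂ - A₂ * I)) * I) := by
    have e1 : I * (J * A₁) = -(J * A₁ * I) := by
      rw [mul_assoc, hA1, ← mul_assoc, ← mul_assoc, hJI]; simp
    have e2 : I * (A₁ * J) = -(A₁ * J * I) := by
      rw [mul_assoc, hJI, mul_neg, ← mul_assoc, ← mul_assoc, hA1]; simp
    simp only [mul_add, add_mul, mul_sub, sub_mul, e1, e2]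
    simp only [← mul_assoc, hq.II]
    simp only [mul_assoc, hq.II]
    noncomm_ring
  obtain ⟨h3, h4⟩ := eq_zero_of_commute_of_anticommute hq.II hX hY e
  refine ⟨h3, ?_⟩
  -- Both commutators double because `A₁` anticommutes with `J` and `A₂` with `I`.
  rw [hA1J, hA2I] at h4
  have : (2 : ℝ) • (J * A₁ + I * A₂) = 0 := by rw [two_smul, ← h4]; abel
  exact (smul_eq_zero.1 this).resolve_left two_ne_zero

/-- The constraint says `A₂ = K A₁`, and `K` anticommutes with `A₁`; by cyclicity `tr(A₁ K A₁)` is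
its own negative. -/
theorem trace_skew_eq_zero (hq : IsQuaternionTriple I J K)
    (hA1I : A₁ * I = I * A₁) (hA1J : A₁ * J = -(J * A₁)) (hA : J * A₁ + I * A₂ = 0) :
    (A₁ * A₂).trace = 0 := by
  have hA2 : A₂ = K * A₁ := by
    have := congrArg (I * ·) hA
    simp only [mul_add, ← mul_assoc, hq.II, hq.IJ, mul_zero] at this
    simp only [neg_mul, one_mul] at this
    exact (sub_eq_zero.1 (by rw [sub_eq_add_neg]; exact this)).symm
  have hK : A₁ * K = -(K * A₁) := by
    rw [← hq.IJ, ← mul_assoc, hA1I, mul_assoc, hA1J]; noncomm_ring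
  have h1 : (A₁ * (K * A₁)).trace = -(A₁ * (K * A₁)).trace := by
    calc (A₁ * (K * A₁)).trace = -(K * A₁ * A₁).trace := by
          rw [← mul_assoc, hK, neg_mul, trace_neg]
      _ = _ := by rw [trace_mul_comm]
  rw [hA2]; linarith

theorem trace_mul_sym (hq : IsQuaternionTriple I J K)
    (h1 : S₁ * I = -(I * S₁)) (h2 : S₂ * J = -(J * S₂)) (h3 : S₃ * K = -(K * S₃))
    (h23 : K * S₂ + S₂ * K + (J * S₃ + S₃ * J) = 0) :
    (I * S₁ * S₃).trace = (S₁ * S₂).trace := by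
  -- The relation `h23` multiplied by `J` and then by `I`. Pairing the outcome with `S₁`, which
  -- anticommutes with `I`, doubles each of the two traces to be compared.
  have key : S₃ * I - I * S₃ = S₂ + I * S₂ * I := by
    have e1 : S₃ = J * S₃ * J + I * S₂ - S₂ * I := by
      have := congrArg (J * ·) h23
      simp only [mul_add, ← mul_assoc, hq.JJ, hq.JK, mul_zero] at this
      have e : J * S₂ * K = -(S₂ * I) := by rw [← neg_eq_iff_eq_neg.2 h2, neg_mul, mul_assoc, hq.JK]
      rw [e, neg_mul, one_mul] at this
      rw [← sub_eq_zero, ← neg_eq_zero, ← this]; abel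
    have e2 : I * (J * S₃ * J) = S₃ * I := by
      rw [← mul_assoc, ← mul_assoc, hq.IJ, ← neg_eq_iff_eq_neg.2 h3, neg_mul, mul_assoc, hq.KJ]
      simp
    have := congrArg (I * ·) e1
    simp only [mul_add, mul_sub, e2] at this
    rw [this]
    simp only [← mul_assoc, hq.II]
    noncomm_ring
  have t1 : (S₁ * (I * S₃)).trace = -(I * S₁ * S₃).trace := by
    rw [← mul_assoc, h1, neg_mul, trace_neg]
  have t2 : (S₁ * (S₃ * I)).trace = (I * S₁ * S₃).trace := by
    rw [← mul_assoc, trace_mul_comm, mul_assoc]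
  have t3 : (S₁ * (I * S₂ * I)).trace = (S₁ * S₂).trace := by
    calc (S₁ * (I * S₂ * I)).trace = (S₁ * I * S₂ * I).trace := by simp only [mul_assoc]
      _ = -((I * S₁ * S₂) * I).trace := by rw [h1]; simp
      _ = -(I * (I * S₁ * S₂)).trace := by rw [trace_mul_comm]
      _ = _ := by simp only [← mul_assoc, hq.II]; simp
  have h := congrArg (fun X ↦ (S₁ * X).trace) key
  simp only [mul_sub, mul_add, trace_sub, trace_add, t1, t2, t3] at h
  linarith

/-- Consequences of the constraints that the curvature identities impose on the torsion. -/
theorem trace_torsion (hq : IsQuaternionTriple I J K)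
    (hI : I.transpose = -I) {T₁ T₂ T₃ : Matrix (Fin h) (Fin h) ℝ}
    (h11 : I * T₁ + T₁.transpose * I = 0) (h22 : J * T₂ + T₂.transpose * J = 0)
    (h33 : K * T₃ + T₃.transpose * K = 0)
    (h12 : J * T₁ + T₁.transpose * J + (I * T₂ + T₂.transpose * I) = 0)
    (h23 : K * T₂ + T₂.transpose * K + (J * T₃ + T₃.transpose * J) = 0)
    (hP₁ : skewPart T₁ = I * skewPart T₁ * I + J * skewPart T₁ * J + K * skewPart T₁ * K)
    (hP₂ : skewPart T₂ = I * skewPart T₂ * I + J * skewPart T₂ * J + K * skewPart T₂ * K)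
    (hP₃ : skewPart T₃ = I * skewPart T₃ * I + J * skewPart T₃ * J + K * skewPart T₃ * K) :
    (I * (T₁ * T₃ - T₃ * T₁)).trace = 2 * matInner (symPart T₁) (symPart T₂) ∧
      matInner (skewPart T₁) (skewPart T₂) = 0 := by
  have hT : ∀ T : Matrix (Fin h) (Fin h) ℝ, T = symPart T + skewPart T := fun T ↦ by
    simp only [symPart, skewPart]; module
  have hT' : ∀ T : Matrix (Fin h) (Fin h) ℝ, T.transpose = symPart T - skewPart T := fun T ↦ by
    simp only [symPart, skewPart]; module
  have split : ∀ L T : Matrix (Fin h) (Fin h) ℝ, L * T + T.transpose * L =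
      L * symPart T + symPart T * L + (L * skewPart T - skewPart T * L) := fun L T ↦ by
    rw [hT' T]; nth_rewrite 1 [hT T]; noncomm_ring
  rw [split] at h11 h22 h33
  rw [split, split] at h12 h23
  obtain ⟨s1, a1⟩ := diagonal_constraint hq.II h11
  obtain ⟨s2, a2⟩ := diagonal_constraint hq.JJ h22
  obtain ⟨s3, a3⟩ := diagonal_constraint hq.KK h33
  have a1J := anticommute_of_proj_eq_zero hq a1 hP₁
  have a2I := anticommute_of_proj_eq_zero hq.swap a2 (by
    rw [add_comm (I * skewPart T₂ * I)] at hP₂; simpa using hP₂)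
  have a2K := anticommute_of_proj_eq_zero hq.rotate a2 (by
    rw [add_rotate] at hP₂; exact hP₂)
  have a3J := anticommute_of_proj_eq_zero hq.rotate.swap a3 (by
    rw [add_rotate, add_comm (J * skewPart T₃ * J)] at hP₃; simpa using hP₃)
  obtain ⟨-, r12⟩ := offdiagonal_constraint hq s1 a1 a1J a2I h12
  obtain ⟨r23, -⟩ := offdiagonal_constraint hq.rotate s2 a2 a2K a3J h23
  have hsym : ∀ T : Matrix (Fin h) (Fin h) ℝ, (symPart T).transpose = symPart T := fun T ↦ by
    simp [symPart, add_comm]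
  have hskew : ∀ T : Matrix (Fin h) (Fin h) ℝ, (skewPart T).transpose = -skewPart T := fun T ↦ by
    simp [skewPart, smul_sub]
  -- `I` is skew-symmetric and anticommutes with the symmetric part of `T₁`, so their product is
  -- symmetric, hence orthogonal to skew-symmetric matrices.
  have t0 : (I * symPart T₁ * skewPart T₃).trace = 0 := by
    have : (I * symPart T₁ * skewPart T₃).trace = -(I * symPart T₁ * skewPart T₃).trace := by
      nth_rewrite 1 [← trace_transpose]
      rw [transpose_mul, transpose_mul, hsym, hskew, hI, mul_neg, s1, neg_neg, neg_mul, trace_neg,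
        trace_mul_comm]
    linarith
  -- The skew part commutes with `I` and drops out; the symmetric part anticommutes and is doubled.
  -- This is the source of the factor two.
  have c1 : I * T₁ - T₁ * I = (2 : ℝ) • (I * symPart T₁) := by
    have : I * T₁ - T₁ * I = I * (symPart T₁ + skewPart T₁) - (symPart T₁ + skewPart T₁) * I := by
      rw [← hT]
    rw [this, add_mul, mul_add, s1, a1, two_smul]; abel
  refine ⟨?_, ?_⟩
  · calc (I * (T₁ * T₃ - T₃ * T₁)).trace = ((I * T₁ - T₁ * I) * T₃).trace := by
          rw [mul_sub, sub_mul, trace_sub, trace_sub, ← mul_assoc, ← mul_assoc,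
            trace_mul_comm (I * T₃), ← mul_assoc]
      _ = 2 * (I * symPart T₁ * symPart T₃).trace := by
          have : (2 : ℝ) • (I * symPart T₁) * T₃ =
              (2 : ℝ) • (I * symPart T₁) * (symPart T₃ + skewPart T₃) := by rw [← hT]
          rw [c1, this, mul_add, smul_mul_assoc, smul_mul_assoc, trace_add, trace_smul, trace_smul, t0]
          simp
      _ = _ := by
          rw [trace_mul_sym hq s1 s2 s3 r23, matInner, hsym, trace_mul_comm]
  · rw [matInner, hskew, neg_mul, trace_neg, trace_mul_comm, trace_skew_eq_zero hq a1 a1J r12,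
      neg_zero]

end Constraint

/-! ### Adapted frames, their expansions, and connection and curvature matrices. -/

section Frames

open VectorField

set_option linter.unusedSectionVars false

variable {n h : ℕ} {M : Type*} [TopologicalSpace M]
  [ChartedSpace (EuclideanSpace ℝ (Fin n)) M] [IsManifold (𝓡 n) ∞ M]

/-- The data of a horizontal orthonormal frame, a vertical orthonormal frame and its dual coframe
for a Biquard connection. -/
structure IsBiquardFrame (S : SubRiemannian n h M) (V : Distribution n M)
    (g : SubRiemannian.Metric n M) (nabla : Connection n M) (O : Set M)
    (e : Fin h → Π q : M, S.H q) (η : Fin 3 → OneForm n M) (U : Fin 3 → Π q : M, V q) : Prop where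
  isOpen : IsOpen O
  biquard : S.IsBiquard V g nabla
  frame : S.IsOrthonormalFrame O e
  coframe : S.IsCoframe O η
  dual : SubRiemannian.IsDualFrame O η U
  orthonormal : ∀ q ∈ O, ∀ a b, g.inner q (U a q) (U b q) = delta a b

namespace IsBiquardFrame

variable {S : SubRiemannian n h M} {V : Distribution n M} {g : SubRiemannian.Metric n M}
  {nabla : Connection n M} {O : Set M} {e : Fin h → Π q : M, S.H q} {η : Fin 3 → OneForm n M}
  {U : Fin 3 → Π q : M, V q} {q : M}

theorem inner_e (F : IsBiquardFrame S V g nabla O e η U) (hq : q ∈ O) (i j : Fin h) :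
    g.inner q (e i q) (e j q) = delta i j := by
  rw [F.biquard.extension.horizontal, F.frame.2 q hq]

theorem inner_HV (F : IsBiquardFrame S V g nabla O e η U) {x u : TangentSpace (𝓡 n) q}
    (hx : x ∈ S.H q) (hu : u ∈ V q) : g.inner q x u = 0 :=
  F.biquard.extension.orthogonal q x hx u hu

theorem inner_VH (F : IsBiquardFrame S V g nabla O e η U) {x u : TangentSpace (𝓡 n) q}
    (hx : x ∈ S.H q) (hu : u ∈ V q) : g.inner q u x = 0 := by
  rw [g.symm]; exact F.inner_HV hx hu

end IsBiquardFrame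

open Classical in
theorem Connection.nabla_mem {W : Distribution n M} {nabla : Connection n M}
    (hW : ∀ O : Set M, IsOpen O → ∀ Y : Π q : M, W q, SmoothField (toField Y) O →
      ∀ p ∈ O, ∀ v, nabla (toField Y) p v ∈ W p) {O : Set M} (hO : IsOpen O) {q : M} (hq : q ∈ O)
    {X : VField n M} (hX : SmoothField X O) (hXW : ∀ q ∈ O, X q ∈ W q)
    (v : TangentSpace (𝓡 n) q) : nabla X q v ∈ W q := by
  -- `parallel_H` and `parallel_V` concern total sections; the default value zero where `X` leaves
  -- `W` makes one that agrees with `X` on `O`.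
  let X' : Π q : M, W q := fun q ↦ if hq : X q ∈ W q then ⟨X q, hq⟩ else 0
  have hXX' : ∀ q ∈ O, X q = toField X' q := fun q hq ↦ by simp [toField, X', hXW q hq]
  rw [nabla.congr hO hX hXX' hq]
  exact hW O hO X' (hX.congr fun q hq ↦ (hXX' q hq).symm) q hq v

/-- On horizontal fields the exterior derivative of a form annihilating `H` is its torsion
component. -/
theorem dForm_eq_torsion {S : SubRiemannian n h M} {V : Distribution n M}
    {g : SubRiemannian.Metric n M} {nabla : Connection n M} (hB : S.IsBiquard V g nabla)
    {O : Set M} (hO : IsOpen O) {η : Fin 3 → OneForm n M} (hη : S.IsCoframe O η)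
    {q : M} (hq : q ∈ O) (a : Fin 3)
    {X Y : VField n M} (hX : SmoothField X O) (hY : SmoothField Y O)
    (hXH : ∀ q ∈ O, X q ∈ S.H q) (hYH : ∀ q ∈ O, Y q ∈ S.H q) :
    dForm (η a) X Y q = η a q (nabla.torsion q (X q) (Y q)) := by
  have hη : ∀ q ∈ O, ∀ x ∈ S.H q, η a q x = 0 := fun q hq x hx ↦ ((hη.2 q hq).2 x).1 hx a
  -- On horizontal fields the functions `η(X)`, `η(Y)` are zero, and so are `η(∇_X Y)`, `η(∇_Y X)`
  -- as `H` is parallel; `dη` and `η ∘ Tor` both reduce to `-η([X, Y])`.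
  rw [dForm, dFun_eq_zero hO hq fun q hq ↦ hη q hq _ (hXH q hq),
    dFun_eq_zero hO hq fun q hq ↦ hη q hq _ (hYH q hq),
    Connection.torsion_eq hO hq hX hY, map_sub, map_sub,
    hη q hq (nabla.along X Y q) (Connection.nabla_mem hB.parallel_H hO hq hY hYH _),
    hη q hq (nabla.along Y X q) (Connection.nabla_mem hB.parallel_H hO hq hX hXH _)]
  simp

/-- Expansion of a vector in an orthonormal family that spans a subspace. -/
theorem expand_of_finrank {g : SubRiemannian.Metric n M} {q : M}
    {k : ℕ} {W : Submodule ℝ (TangentSpace (𝓡 n) q)} (hW : Module.finrank ℝ W = k)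
    {f : Fin k → W} (hf : ∀ i j, g.inner q (f i) (f j) = delta i j)
    {v : TangentSpace (𝓡 n) q} (hv : v ∈ W) :
    v = ∑ i, g.inner q v (f i) • (f i : TangentSpace (𝓡 n) q) := by
  have coef : ∀ (c : Fin k → ℝ) j,
      g.inner q (∑ i, c i • (f i : TangentSpace (𝓡 n) q)) (f j) = c j := by
    intro c j
    simp [map_sum, hf, delta]
  -- Orthonormality gives independence, and the rank of `W` then makes the family a basis.
  have hli : LinearIndependent ℝ f := by
    rw [Fintype.linearIndependent_iff]
    intro c hc j
    have h0 : (∑ i, c i • (f i : TangentSpace (𝓡 n) q)) = 0 := by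
      simpa using congrArg (Subtype.val) hc
    rw [← coef c j, h0]; simp
  have : FiniteDimensional ℝ (TangentSpace (𝓡 n) q) :=
    inferInstanceAs (FiniteDimensional ℝ (EuclideanSpace ℝ (Fin n)))
  have hspan : Submodule.span ℝ (Set.range f) = ⊤ :=
    hli.span_eq_top_of_card_eq_finrank' (by simp [hW])
  have hmem : (⟨v, hv⟩ : W) ∈ Submodule.span ℝ (Set.range f) := hspan ▸ Submodule.mem_top
  obtain ⟨c, hc⟩ := (Submodule.mem_span_range_iff_exists_fun ℝ).1 hmem
  have hv' : v = ∑ i, c i • (f i : TangentSpace (𝓡 n) q) := by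
    simpa using (congrArg Subtype.val hc).symm
  calc v = ∑ i, c i • (f i : TangentSpace (𝓡 n) q) := hv'
    _ = _ := by
      refine Finset.sum_congr rfl fun i _ ↦ ?_
      conv_rhs => rw [hv', coef]

namespace IsBiquardFrame

variable {S : SubRiemannian n h M} {V : Distribution n M} {g : SubRiemannian.Metric n M}
  {nabla : Connection n M} {O : Set M} {e : Fin h → Π q : M, S.H q} {η : Fin 3 → OneForm n M}
  {U : Fin 3 → Π q : M, V q} {q : M}

theorem expand_H (F : IsBiquardFrame S V g nabla O e η U) (hq : q ∈ O)
    {v : TangentSpace (𝓡 n) q} (hv : v ∈ S.H q) :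
    v = ∑ i, g.inner q v (e i q) • (e i q : TangentSpace (𝓡 n) q) :=
  expand_of_finrank (S.smooth_H.1 q) (f := fun i ↦ e i q) (F.inner_e hq) hv

theorem expand_V (F : IsBiquardFrame S V g nabla O e η U) (hq : q ∈ O)
    {v : TangentSpace (𝓡 n) q} (hv : v ∈ V q) :
    v = ∑ a, g.inner q v (U a q) • (U a q : TangentSpace (𝓡 n) q) :=
  expand_of_finrank (F.biquard.complement.1.1 q) (f := fun a ↦ U a q) (F.orthonormal q hq) hv

/-- Both sides vanish on `H` and agree on the orthonormal frame `U`, so the coframe is the metric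
dual of `U`. -/
theorem eta_eq (F : IsBiquardFrame S V g nabla O e η U) (hq : q ∈ O) (a : Fin 3)
    (v : TangentSpace (𝓡 n) q) : η a q v = g.inner q v (U a q) := by
  have hv : v ∈ S.H q ⊔ V q := by rw [(F.biquard.complement.2 q).sup_eq_top]; trivial
  obtain ⟨x, hx, u, hu, rfl⟩ := Submodule.mem_sup.1 hv
  have h1 : η a q x = 0 := ((F.coframe.2 q hq).2 x).1 hx a
  have h2 := F.inner_HV hx (U a q).2
  rw [map_add, map_add, add_apply, h1, h2, zero_add, zero_add]
  nth_rewrite 1 [F.expand_V hq hu]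
  simp [map_sum, F.dual.2 q hq, delta]

theorem smooth_U (F : IsBiquardFrame S V g nabla O e η U) (a : Fin 3) :
    SmoothField (toField (U a)) O := F.dual.1 a

theorem smooth_e (F : IsBiquardFrame S V g nabla O e η U) (i : Fin h) :
    SmoothField (toField (e i)) O := F.frame.1 i

theorem nabla_e_mem (F : IsBiquardFrame S V g nabla O e η U) (hq : q ∈ O) (i : Fin h)
    (v : TangentSpace (𝓡 n) q) : nabla (toField (e i)) q v ∈ S.H q :=
  F.biquard.parallel_H O F.isOpen (e i) (F.smooth_e i) q hq v

theorem nabla_U_mem (F : IsBiquardFrame S V g nabla O e η U) (hq : q ∈ O) (a : Fin 3)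
    (v : TangentSpace (𝓡 n) q) : nabla (toField (U a)) q v ∈ V q :=
  F.biquard.parallel_V O F.isOpen (U a) (F.smooth_U a) q hq v

theorem nabla_mem_H (F : IsBiquardFrame S V g nabla O e η U) (hq : q ∈ O) {X : VField n M}
    (hX : SmoothField X O) (hXH : ∀ q ∈ O, X q ∈ S.H q) (v : TangentSpace (𝓡 n) q) :
    nabla X q v ∈ S.H q :=
  Connection.nabla_mem F.biquard.parallel_H F.isOpen hq hX hXH v

theorem nabla_mem_V (F : IsBiquardFrame S V g nabla O e η U) (hq : q ∈ O) {X : VField n M}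
    (hX : SmoothField X O) (hXV : ∀ q ∈ O, X q ∈ V q) (v : TangentSpace (𝓡 n) q) :
    nabla X q v ∈ V q :=
  Connection.nabla_mem F.biquard.parallel_V F.isOpen hq hX hXV v

end IsBiquardFrame

/-! ### Connection and curvature matrices -/

section Matrices

variable {ι : Type*} [Fintype ι] {O : Set M} {p : M}

/-- The matrix of the connection along `v` in a frame. -/
def conMatrix (g : SubRiemannian.Metric n M) (nabla : Connection n M) (f : ι → VField n M) (q : M)
    (v : TangentSpace (𝓡 n) q) : Matrix ι ι ℝ :=
  Matrix.of fun k i ↦ g.inner q (nabla (f i) q v) (f k q)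

/-- The entrywise derivative of a matrix-valued function. -/
def dMat {κ : Type*} (A : M → Matrix ι κ ℝ) (p : M) (v : TangentSpace (𝓡 n) p) : Matrix ι κ ℝ :=
  Matrix.of fun i j ↦ dFun (fun q ↦ A q i j) p v

/-- The matrix of the curvature in a frame. -/
def curvMatrix (g : SubRiemannian.Metric n M) (nabla : Connection n M) (f : ι → VField n M)
    (X Y : VField n M) (p : M) : Matrix ι ι ℝ :=
  dMat (fun q ↦ conMatrix g nabla f q (Y q)) p (X p)
    - dMat (fun q ↦ conMatrix g nabla f q (X q)) p (Y p)
    + conMatrix g nabla f p (X p) * conMatrix g nabla f p (Y p)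
    - conMatrix g nabla f p (Y p) * conMatrix g nabla f p (X p)
    - conMatrix g nabla f p (mlieBracket (𝓡 n) X Y p)

variable {g : SubRiemannian.Metric n M} {nabla : Connection n M}

theorem conMatrix_smooth [T2Space M] (hn : nabla.ContMDiffCovariantDerivative ∞) (hO : IsOpen O)
    {f : ι → VField n M} (hf : ∀ i, SmoothField (f i) O) {Z : VField n M} (hZ : SmoothField Z O)
    (k i : ι) : SmoothFun (n := n) (fun q ↦ conMatrix g nabla f q (Z q) k i) O :=
  SmoothFun.inner (hZ.along hn hO (hf i)) (hf k)

theorem conMatrix_skew [DecidableEq ι] (hO : IsOpen O)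
    (hg : ∀ O : Set M, IsOpen O → ∀ X Y : VField n M, SmoothField X O → SmoothField Y O →
      ∀ p ∈ O, ∀ v, dFun (fun q ↦ g.inner q (X q) (Y q)) p v =
        g.inner p (nabla X p v) (Y p) + g.inner p (X p) (nabla Y p v))
    {f : ι → VField n M} (hf : ∀ i, SmoothField (f i) O)
    (horth : ∀ q ∈ O, ∀ i j, g.inner q (f i q) (f j q) = if i = j then 1 else 0)
    (hp : p ∈ O) (v : TangentSpace (𝓡 n) p) :
    (conMatrix g nabla f p v).transpose = -conMatrix g nabla f p v := by
  ext i k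
  have h := hg O hO (f i) (f k) (hf i) (hf k) p hp v
  rw [dFun_eq_zero hO hp fun q hq ↦ horth q hq i k] at h
  simp only [conMatrix, Matrix.transpose_apply, Matrix.of_apply, Matrix.neg_apply]
  rw [g.symm p _ (f i p)]
  have h0 : (0 : TangentSpace (𝓡 n) p →L[ℝ] ℝ) v = 0 := rfl
  rw [h0] at h
  linarith

/-- Cartan's structure equation: differentiating `∇_Y f_i = ∑ ω(Y)_ki f_k` along `X` gives the
derivative of `ω(Y)` plus the product `ω(X) ω(Y)`, and antisymmetrization yields `dω + ω ∧ ω`. -/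
theorem curvature_frame [T2Space M] (hn : nabla.ContMDiffCovariantDerivative ∞) (hO : IsOpen O)
    (hp : p ∈ O) {f : ι → VField n M} (hf : ∀ i, SmoothField (f i) O)
    (hexp : ∀ q ∈ O, ∀ i v, nabla (f i) q v = ∑ k, conMatrix g nabla f q v k i • f k q)
    {X Y : VField n M} (hX : SmoothField X O) (hY : SmoothField Y O) (i : ι) :
    nabla.curvature X Y (f i) p = ∑ k, curvMatrix g nabla f X Y p k i • f k p := by
  have key : ∀ {X Y : VField n M}, SmoothField X O → SmoothField Y O →
      nabla (nabla.along Y (f i)) p (X p) =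
        ∑ k, (dMat (fun q ↦ conMatrix g nabla f q (Y q)) p (X p)
          + conMatrix g nabla f p (X p) * conMatrix g nabla f p (Y p)) k i • f k p := by
    intro X Y hX hY
    rw [nabla.congr hO (hY.along hn hO (hf i)) (fun q hq ↦ hexp q hq i (Y q)) hp,
      Connection.sum_smul_apply hO hp Finset.univ
        (fun k _ ↦ conMatrix_smooth hn hO hf hY k i) fun k _ ↦ hf k]
    simp only [Matrix.add_apply, add_smul, Finset.sum_add_distrib, Matrix.mul_apply,
      Finset.sum_smul]
    rw [add_comm, Finset.sum_comm]
    congr 1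
    refine Finset.sum_congr rfl fun k _ ↦ ?_
    rw [hexp p hp k (X p), Finset.smul_sum]
    refine Finset.sum_congr rfl fun l _ ↦ ?_
    rw [smul_smul, mul_comm]
  have h1 := key hX hY
  have h2 := key hY hX
  simp only [Connection.curvature, Pi.sub_apply]
  rw [show nabla.along X (nabla.along Y (f i)) p = _ from h1,
    show nabla.along Y (nabla.along X (f i)) p = _ from h2,
    show nabla.along (mlieBracket (𝓡 n) X Y) (f i) p = _ from hexp p hp i _,
    ← Finset.sum_sub_distrib, ← Finset.sum_sub_distrib]
  refine Finset.sum_congr rfl fun k _ ↦ ?_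
  rw [← sub_smul, ← sub_smul]
  congr 1
  simp only [curvMatrix, Matrix.add_apply, Matrix.sub_apply]
  ring

end Matrices

end Frames

/-! ### Torsion components in an adapted frame, and the parallelism of `𝓙` in matrix form. -/

section FrameIdentities

open VectorField

set_option linter.unusedSectionVars false

variable {n h : ℕ} {M : Type*} [TopologicalSpace M]
  [ChartedSpace (EuclideanSpace ℝ (Fin n)) M] [IsManifold (𝓡 n) ∞ M]

/-- The connection matrix in the horizontal (or vertical) frame underlying a family of sections. -/
abbrev conFrame {k : ℕ} {W : Distribution n M} (g : SubRiemannian.Metric n M)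
    (nabla : Connection n M) (f : Fin k → Π q : M, W q) (q : M) (v : TangentSpace (𝓡 n) q) :
    Matrix (Fin k) (Fin k) ℝ :=
  conMatrix g nabla (fun i ↦ toField (f i)) q v

/-- The curvature matrix in the horizontal (or vertical) frame underlying a family of sections. -/
abbrev curvFrame {k : ℕ} {W : Distribution n M} (g : SubRiemannian.Metric n M)
    (nabla : Connection n M) (f : Fin k → Π q : M, W q) (X Y : VField n M) (q : M) :
    Matrix (Fin k) (Fin k) ℝ :=
  curvMatrix g nabla (fun i ↦ toField (f i)) X Y q

/-- The components `g(Tor(U_a, U_b), U_c)` of the vertical torsion. -/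
def vertTor {V : Distribution n M} (g : SubRiemannian.Metric n M) (nabla : Connection n M)
    (U : Fin 3 → Π q : M, V q) (q : M) (a b c : Fin 3) : ℝ :=
  g.inner q (nabla.torsion q (U a q) (U b q)) (U c q)

namespace IsBiquardFrame

variable {S : SubRiemannian n h M} {V : Distribution n M} {g : SubRiemannian.Metric n M}
  {nabla : Connection n M} {O : Set M} {e : Fin h → Π q : M, S.H q} {η : Fin 3 → OneForm n M}
  {U : Fin 3 → Π q : M, V q} {q p : M}

theorem nabla_e (F : IsBiquardFrame S V g nabla O e η U) (hq : q ∈ O) (i : Fin h)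
    (v : TangentSpace (𝓡 n) q) :
    nabla (toField (e i)) q v = ∑ k, conFrame g nabla e q v k i • toField (e k) q :=
  F.expand_H hq (F.nabla_e_mem hq i v)

theorem nabla_U (F : IsBiquardFrame S V g nabla O e η U) (hq : q ∈ O) (a : Fin 3)
    (v : TangentSpace (𝓡 n) q) :
    nabla (toField (U a)) q v = ∑ b, conFrame g nabla U q v b a • toField (U b) q :=
  F.expand_V hq (F.nabla_U_mem hq a v)

theorem skew_e (F : IsBiquardFrame S V g nabla O e η U) (hq : q ∈ O)
    (v : TangentSpace (𝓡 n) q) :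
    (conFrame g nabla e q v).transpose = -conFrame g nabla e q v :=
  conMatrix_skew F.isOpen F.biquard.parallel_g F.smooth_e (fun _ hq ↦ F.inner_e hq) hq v

theorem skew_U (F : IsBiquardFrame S V g nabla O e η U) (hq : q ∈ O)
    (v : TangentSpace (𝓡 n) q) :
    (conFrame g nabla U q v).transpose = -conFrame g nabla U q v :=
  conMatrix_skew F.isOpen F.biquard.parallel_g F.smooth_U F.orthonormal hq v

theorem torsion_mem_V (F : IsBiquardFrame S V g nabla O e η U) (i j : Fin h) :
    nabla.torsion q (e i q) (e j q) ∈ V q :=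
  F.biquard.torsion_HH q _ (e i q).2 _ (e j q).2

theorem torsion_mem_H (F : IsBiquardFrame S V g nabla O e η U) {u x : TangentSpace (𝓡 n) q}
    (hu : u ∈ V q) (hx : x ∈ S.H q) : nabla.torsion q u x ∈ S.H q := by
  rw [nabla.torsion_antisymm]
  exact (S.H q).neg_mem (F.biquard.torsion_HV q _ hx _ hu)

theorem J_apply (F : IsBiquardFrame S V g nabla O e η U) (hq : q ∈ O) (a : Fin 3) (i j : Fin h) :
    S.J e (η a) q j i = g.inner q (nabla.torsion q (e i q) (e j q)) (U a q) := by
  rw [← F.eta_eq hq]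
  exact dForm_eq_torsion F.biquard F.isOpen F.coframe hq a (F.smooth_e i) (F.smooth_e j) (fun q _ ↦ (e i q).2)
    fun q _ ↦ (e j q).2

theorem torsion_ee (F : IsBiquardFrame S V g nabla O e η U) (hq : q ∈ O) (i j : Fin h) :
    nabla.torsion q (e i q) (e j q) =
      ∑ a, S.J e (η a) q j i • (U a q : TangentSpace (𝓡 n) q) := by
  rw [F.expand_V hq (F.torsion_mem_V i j)]
  simp only [F.J_apply hq]

theorem J_skew (F : IsBiquardFrame S V g nabla O e η U) (hq : q ∈ O) (a : Fin 3) :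
    (S.J e (η a) q).transpose = -S.J e (η a) q := by
  ext i j
  rw [Matrix.transpose_apply, Matrix.neg_apply, F.J_apply hq, F.J_apply hq,
    nabla.torsion_antisymm, map_neg, neg_apply]

theorem torsion_Ue (F : IsBiquardFrame S V g nabla O e η U) (hq : q ∈ O) (a : Fin 3)
    (i : Fin h) : nabla.torsion q (U a q) (e i q) =
      ∑ k, S.torMatrix g nabla e q (U a q) k i • (e k q : TangentSpace (𝓡 n) q) :=
  F.expand_H hq (F.torsion_mem_H (U a q).2 (e i q).2)

theorem torsion_eU (F : IsBiquardFrame S V g nabla O e η U) (hq : q ∈ O) (a : Fin 3)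
    (i : Fin h) : nabla.torsion q (e i q) (U a q) =
      -∑ k, S.torMatrix g nabla e q (U a q) k i • (e k q : TangentSpace (𝓡 n) q) := by
  rw [nabla.torsion_antisymm, F.torsion_Ue hq]

/-- Involutivity acts through this lemma alone: with `[U_a, U_b]` vertical and `V` parallel, the
torsion of vertical vectors has no horizontal component. -/
theorem torsion_UU (F : IsBiquardFrame S V g nabla O e η U) (hV : IsInvolutive V) (hq : q ∈ O)
    (a b : Fin 3) : nabla.torsion q (U a q) (U b q) =
      ∑ c, vertTor g nabla U q a b c • (U c q : TangentSpace (𝓡 n) q) := by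
  refine F.expand_V hq ?_
  have := Connection.torsion_eq (nabla := nabla) F.isOpen hq (F.smooth_U a) (F.smooth_U b)
  rw [show nabla.torsion q (U a q) (U b q) = _ from this]
  exact (V q).sub_mem ((V q).sub_mem (F.nabla_U_mem hq b _) (F.nabla_U_mem hq a _))
    (hV O F.isOpen (U a) (U b) (F.smooth_U a) (F.smooth_U b) q hq)

theorem vertTor_antisymm (a b c : Fin 3) : vertTor g nabla U q a b c = -vertTor g nabla U q b a c := by
  rw [vertTor, nabla.torsion_antisymm, map_neg, neg_apply, vertTor]

theorem smooth_J [T2Space M] (F : IsBiquardFrame S V g nabla O e η U) (a : Fin 3) (j i : Fin h) :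
    SmoothFun (n := n) (fun q ↦ S.J e (η a) q j i) O :=
  SmoothFun.congr (SmoothFun.inner (g := g) (SmoothField.torField F.biquard.smooth F.isOpen
    (F.smooth_e i) (F.smooth_e j)) (F.smooth_U a)) fun _ hq ↦ F.J_apply hq a i j

theorem smooth_T [T2Space M] (F : IsBiquardFrame S V g nabla O e η U) (a : Fin 3) (j i : Fin h) :
    SmoothFun (n := n) (fun q ↦ S.torMatrix g nabla e q (U a q) j i) O :=
  SmoothFun.inner (SmoothField.torField F.biquard.smooth F.isOpen
    (F.smooth_U a) (F.smooth_e i)) (F.smooth_e j)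

theorem smooth_vertTor [T2Space M] (F : IsBiquardFrame S V g nabla O e η U) (a b c : Fin 3) :
    SmoothFun (n := n) (fun q ↦ vertTor g nabla U q a b c) O :=
  SmoothFun.inner (SmoothField.torField F.biquard.smooth F.isOpen
    (F.smooth_U a) (F.smooth_U b)) (F.smooth_U c)

/-- The equation `∇ 𝓙 = 0` in frames, with `θ` the connection matrix of `V` and `ω` that of `H`:
`Z(J_a) = -∑ θ_ab J_b + [J_a, ω]`. -/
theorem dMat_J [T2Space M] (F : IsBiquardFrame S V g nabla O e η U) (hp : p ∈ O) (a : Fin 3)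
    {Z : VField n M} (hZ : SmoothField Z O) :
    dMat (fun q ↦ S.J e (η a) q) p (Z p) =
      -∑ b, conFrame g nabla U p (Z p) a b • S.J e (η b) p
      + S.J e (η a) p * conFrame g nabla e p (Z p)
      - conFrame g nabla e p (Z p) * S.J e (η a) p := by
  ext j i
  have hmem : ∀ i, ∀ q ∈ O, nabla.along Z (toField (e i)) q ∈ S.H q :=
    fun i q hq ↦ F.nabla_e_mem hq i _
  have hsm : ∀ i, SmoothField (nabla.along Z (toField (e i))) O :=
    fun i ↦ hZ.along F.biquard.smooth F.isOpen (F.smooth_e i)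
  have h := F.biquard.parallel_J O F.isOpen η F.coframe U F.dual (e i) (e j) (F.smooth_e i)
    (F.smooth_e j) Z hZ p hp a
  have hJ1 : dForm (η a) (nabla.along Z (toField (e i))) (toField (e j)) p =
      ∑ k, conFrame g nabla e p (Z p) k i * S.J e (η a) p j k := by
    rw [dForm_eq_torsion F.biquard F.isOpen F.coframe hp a (hsm i) (F.smooth_e j) (hmem i) fun q _ ↦ (e j q).2, F.eta_eq hp]
    simp only [F.J_apply hp, Connection.along, F.nabla_e hp]
    simp [map_sum, -Matrix.of_apply, toField]
  have hJ2 : dForm (η a) (toField (e i)) (nabla.along Z (toField (e j))) p =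
      ∑ k, conFrame g nabla e p (Z p) k j * S.J e (η a) p k i := by
    rw [dForm_eq_torsion F.biquard F.isOpen F.coframe hp a (F.smooth_e i) (hsm j) (fun q _ ↦ (e i q).2) (hmem j), F.eta_eq hp]
    simp only [F.J_apply hp, Connection.along, F.nabla_e hp]
    simp [map_sum, -Matrix.of_apply, toField]
  -- Differentiating the second argument produces `ωᵀ J_a`, which skewness of `ω` turns into `-ω
  -- J_a`.
  have hskew : ∀ k, conFrame g nabla e p (Z p) k j = -conFrame g nabla e p (Z p) j k := fun k ↦
    congrFun (congrFun (F.skew_e hp (Z p)) j) k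
  rw [hJ1, hJ2] at h
  simp only [hskew] at h
  refine Eq.trans h ?_
  have hη : ∀ b, η a p (nabla (toField (U b)) p (Z p)) = conFrame g nabla U p (Z p) a b :=
    fun b ↦ F.eta_eq hp a _
  simp only [hη, Matrix.sub_apply, Matrix.add_apply, Matrix.neg_apply, Matrix.sum_apply,
    Matrix.smul_apply, Matrix.mul_apply, smul_eq_mul]
  have hdJ : ∀ b, dForm (η b) (toField (e i)) (toField (e j)) p = S.J e (η b) p j i :=
    fun b ↦ rfl
  simp only [hdJ, neg_mul, Finset.sum_neg_distrib, sub_eq_add_neg]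
  congr 2
  exact Finset.sum_congr rfl fun k _ ↦ mul_comm _ _

end IsBiquardFrame

end FrameIdentities

/-! ### Entrywise differentiation of matrix-valued functions. -/

section MatrixCalculus

open VectorField

set_option linter.unusedSectionVars false

variable {n : ℕ} {M : Type*} [TopologicalSpace M]
  [ChartedSpace (EuclideanSpace ℝ (Fin n)) M] [IsManifold (𝓡 n) ∞ M]
  {ι κ μ : Type*} {O : Set M} {p : M}

variable (n) in
/-- A matrix-valued function with smooth entries. -/
def SmoothMat (A : M → Matrix ι κ ℝ) (O : Set M) : Prop :=
  ∀ i j, SmoothFun (n := n) (fun q ↦ A q i j) O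

theorem dMat_congr {A B : M → Matrix ι κ ℝ} (hO : IsOpen O) (hp : p ∈ O)
    (h : ∀ q ∈ O, A q = B q) (v : TangentSpace (𝓡 n) p) : dMat A p v = dMat B p v := by
  ext i j
  simp only [dMat, Matrix.of_apply]
  rw [dFun_congr hO hp fun q hq ↦ by rw [h q hq]]

theorem dMat_add {A B : M → Matrix ι κ ℝ} (hO : IsOpen O) (hp : p ∈ O) (hA : SmoothMat n A O)
    (hB : SmoothMat n B O) (v : TangentSpace (𝓡 n) p) :
    dMat (fun q ↦ A q + B q) p v = dMat A p v + dMat B p v := by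
  ext i j
  exact dFun_add hO hp (hA i j) (hB i j) v

theorem dMat_sub {A B : M → Matrix ι κ ℝ} (hO : IsOpen O) (hp : p ∈ O) (hA : SmoothMat n A O)
    (hB : SmoothMat n B O) (v : TangentSpace (𝓡 n) p) :
    dMat (fun q ↦ A q - B q) p v = dMat A p v - dMat B p v := by
  ext i j
  exact dFun_sub hO hp (hA i j) (hB i j) v

theorem dMat_neg {A : M → Matrix ι κ ℝ} (v : TangentSpace (𝓡 n) p) :
    dMat (fun q ↦ -A q) p v = -dMat A p v := by
  ext i j
  exact dFun_neg v

theorem dMat_smul {f : M → ℝ} {A : M → Matrix ι κ ℝ} (hO : IsOpen O) (hp : p ∈ O)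
    (hf : SmoothFun (n := n) f O) (hA : SmoothMat n A O) (v : TangentSpace (𝓡 n) p) :
    dMat (fun q ↦ f q • A q) p v = dFun f p v • A p + f p • dMat A p v := by
  ext i j
  exact dFun_mul hO hp hf (hA i j) v

theorem SmoothMat.add {A B : M → Matrix ι κ ℝ} (hA : SmoothMat n A O) (hB : SmoothMat n B O) :
    SmoothMat n (fun q ↦ A q + B q) O :=
  fun i j ↦ ContMDiffOn.add (hA i j) (hB i j)

theorem SmoothMat.neg {A : M → Matrix ι κ ℝ} (hA : SmoothMat n A O) :
    SmoothMat n (fun q ↦ -A q) O :=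
  fun i j ↦ (hA i j).neg

theorem SmoothMat.smul {f : M → ℝ} {A : M → Matrix ι κ ℝ} (hf : SmoothFun (n := n) f O)
    (hA : SmoothMat n A O) : SmoothMat n (fun q ↦ f q • A q) O :=
  fun i j ↦ hf.mul (hA i j)

theorem SmoothMat.sum {α : Type*} {s : Finset α} {A : α → M → Matrix ι κ ℝ}
    (hA : ∀ a, SmoothMat n (A a) O) : SmoothMat n (fun q ↦ ∑ a ∈ s, A a q) O := fun i j ↦ by
  simp only [Matrix.sum_apply]
  exact SmoothFun.sum fun a _ ↦ hA a i j

theorem SmoothMat.mul [Fintype κ] {A : M → Matrix ι κ ℝ} {B : M → Matrix κ μ ℝ}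
    (hA : SmoothMat n A O) (hB : SmoothMat n B O) : SmoothMat n (fun q ↦ A q * B q) O :=
  fun i j ↦ by
    simp only [Matrix.mul_apply]
    exact SmoothFun.sum fun k _ ↦ (hA i k).mul (hB k j)

theorem dMat_sum {α : Type*} (s : Finset α) {A : α → M → Matrix ι κ ℝ} (hO : IsOpen O)
    (hp : p ∈ O) (hA : ∀ a, SmoothMat n (A a) O) (v : TangentSpace (𝓡 n) p) :
    dMat (fun q ↦ ∑ a ∈ s, A a q) p v = ∑ a ∈ s, dMat (A a) p v := by
  ext i j
  simp only [dMat, Matrix.of_apply, Matrix.sum_apply]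
  exact dFun_sum s hO hp (fun a _ ↦ hA a i j) v

theorem dMat_mul [Fintype κ] {A : M → Matrix ι κ ℝ} {B : M → Matrix κ μ ℝ} (hO : IsOpen O)
    (hp : p ∈ O) (hA : SmoothMat n A O) (hB : SmoothMat n B O) (v : TangentSpace (𝓡 n) p) :
    dMat (fun q ↦ A q * B q) p v = dMat A p v * B p + A p * dMat B p v := by
  ext i j
  simp only [dMat, Matrix.of_apply, Matrix.mul_apply, Matrix.add_apply]
  rw [dFun_sum Finset.univ hO hp fun k _ ↦ (hA i k).mul (hB k j), ← Finset.sum_add_distrib]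
  exact Finset.sum_congr rfl fun k _ ↦ dFun_mul hO hp (hA i k) (hB k j) v

theorem dFun_trace [Fintype ι] {A : M → Matrix ι ι ℝ} (hO : IsOpen O) (hp : p ∈ O)
    (hA : SmoothMat n A O) (v : TangentSpace (𝓡 n) p) :
    dFun (fun q ↦ (A q).trace) p v = (dMat A p v).trace :=
  dFun_sum Finset.univ hO hp (fun i _ ↦ hA i i) v

theorem dMat_mlieBracket (hO : IsOpen O) (hp : p ∈ O) {A : M → Matrix ι κ ℝ} {X Y Z : VField n M}
    (hA : SmoothMat n A O) (hX : SmoothField X O) (hY : SmoothField Y O)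
    (hZ : SmoothField Z O) (hZp : Z p ≠ 0) :
    dMat A p (mlieBracket (𝓡 n) X Y p) =
      dMat (fun q ↦ dMat A q (Y q)) p (X p) - dMat (fun q ↦ dMat A q (X q)) p (Y p) := by
  ext i j
  exact dFun_mlieBracket hO hp (hA i j) hX hY hZ hZp

end MatrixCalculus

/-! ### The action of the curvature on the parallel map `𝓙`. -/

section ParallelCurvature

/-- The purely algebraic half of `commutator_curvature`: connection matrices and their derivatives
are independent symbols. The hypothesis equates the commutator of second derivatives of `J a` with
its derivative along the bracket; the mixed terms in `θ` and `ω` cancel and the rest assemble into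
the two curvatures. -/
theorem commutator_of_second_derivative {h : ℕ} (J : Fin 3 → Matrix (Fin h) (Fin h) ℝ)
    (θX θY dXθY dYθX θB : Matrix (Fin 3) (Fin 3) ℝ) (wX wY dXwY dYwX wB : Matrix (Fin h) (Fin h) ℝ)
    (a : Fin 3)
    (hb : -∑ b, (dXθY a b • J b + θY a b • (-∑ c, θX b c • J c + J b * wX - wX * J b))
        + ((-∑ c, θX a c • J c + J a * wX - wX * J a) * wY + J a * dXwY)
        - (dXwY * J a + wY * (-∑ c, θX a c • J c + J a * wX - wX * J a))
        - (-∑ b, (dYθX a b • J b + θX a b • (-∑ c, θY b c • J c + J b * wY - wY * J b))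
          + ((-∑ c, θY a c • J c + J a * wY - wY * J a) * wX + J a * dYwX)
          - (dYwX * J a + wX * (-∑ c, θY a c • J c + J a * wY - wY * J a))) =
      -∑ b, θB a b • J b + J a * wB - wB * J a) :
    J a * (dXwY - dYwX + wX * wY - wY * wX - wB) - (dXwY - dYwX + wX * wY - wY * wX - wB) * J a =
      ∑ b, (dXθY - dYθX + θX * θY - θY * θX - θB) a b • J b := by
  have hE : ∀ (θ θ' : Matrix (Fin 3) (Fin 3) ℝ) (w : Matrix (Fin h) (Fin h) ℝ),
      ∑ b, θ' a b • (-∑ c, θ b c • J c + J b * w - w * J b) =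
        -∑ b, (θ' * θ) a b • J b + (∑ b, θ' a b • J b) * w - w * ∑ b, θ' a b • J b := by
    intro θ θ' w
    simp only [smul_sub, smul_add, smul_neg, Finset.sum_sub_distrib, Finset.sum_add_distrib,
      Finset.sum_neg_distrib, Finset.sum_mul, Finset.mul_sum, smul_mul_assoc, mul_smul_comm,
      Finset.smul_sum, Matrix.mul_apply, Finset.sum_smul, smul_smul]
    rw [Finset.sum_comm]
  simp only [Finset.sum_add_distrib, hE] at hb
  simp only [Matrix.sub_apply, Matrix.add_apply, sub_smul, add_smul, Finset.sum_sub_distrib,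
    Finset.sum_add_distrib]
  rw [← sub_eq_zero] at hb ⊢
  rw [← hb]
  noncomm_ring

open VectorField

set_option linter.unusedSectionVars false

variable {n h : ℕ} {M : Type*} [TopologicalSpace M]
  [ChartedSpace (EuclideanSpace ℝ (Fin n)) M] [IsManifold (𝓡 n) ∞ M]
  {S : SubRiemannian n h M} {V : Distribution n M} {g : SubRiemannian.Metric n M}
  {nabla : Connection n M} {O : Set M} {e : Fin h → Π q : M, S.H q} {η : Fin 3 → OneForm n M}
  {U : Fin 3 → Π q : M, V q} {q p : M}

namespace IsBiquardFrame

/-- Supplies the nonvanishing field that `dMat_mlieBracket` requires. -/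
theorem U_ne_zero (F : IsBiquardFrame S V g nabla O e η U) (hq : q ∈ O) (a : Fin 3) :
    toField (U a) q ≠ 0 := fun h0 ↦ by
  have := F.orthonormal q hq a a
  rw [show (U a q : TangentSpace (𝓡 n) q) = 0 from h0] at this
  simp at this

theorem dMat_dMat_J [T2Space M] (F : IsBiquardFrame S V g nabla O e η U) (hp : p ∈ O) (a : Fin 3)
    (X : VField n M) {Y : VField n M} (hY : SmoothField Y O) :
    dMat (fun q ↦ dMat (fun q ↦ S.J e (η a) q) q (Y q)) p (X p) =
      -∑ b, (dMat (fun q ↦ conFrame g nabla U q (Y q)) p (X p) a b • S.J e (η b) p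
          + conFrame g nabla U p (Y p) a b • dMat (fun q ↦ S.J e (η b) q) p (X p))
      + (dMat (fun q ↦ S.J e (η a) q) p (X p) * conFrame g nabla e p (Y p)
        + S.J e (η a) p * dMat (fun q ↦ conFrame g nabla e q (Y q)) p (X p))
      - (dMat (fun q ↦ conFrame g nabla e q (Y q)) p (X p) * S.J e (η a) p
        + conFrame g nabla e p (Y p) * dMat (fun q ↦ S.J e (η a) q) p (X p)) := by
  have hO := F.isOpen
  have sJ : ∀ a, SmoothMat n (fun q ↦ S.J e (η a) q) O := fun a i j ↦ F.smooth_J a i j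
  have sω : SmoothMat n (fun q ↦ conFrame g nabla e q (Y q)) O := fun i j ↦
    conMatrix_smooth F.biquard.smooth hO F.smooth_e hY i j
  have sθ : ∀ a b, SmoothFun (n := n) (fun q ↦ conFrame g nabla U q (Y q) a b) O := fun a b ↦
    conMatrix_smooth F.biquard.smooth hO F.smooth_U hY a b
  have s1 : ∀ b, SmoothMat n (fun q ↦ conFrame g nabla U q (Y q) a b • S.J e (η b) q) O :=
    fun b ↦ .smul (sθ a b) (sJ b)
  rw [dMat_congr hO hp (fun q hq ↦ F.dMat_J hq a hY),
    dMat_sub hO hp (.add (.neg (.sum s1)) (.mul (sJ a) sω)) (.mul sω (sJ a)),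
    dMat_add hO hp (.neg (.sum s1)) (.mul (sJ a) sω), dMat_neg, dMat_sum _ hO hp s1,
    dMat_mul hO hp (sJ a) sω, dMat_mul hO hp sω (sJ a)]
  congr 4
  exact funext fun b ↦ dMat_smul hO hp (sθ a b) (sJ b) _

/-- The Ricci identity for a parallel tensor: the curvature of `H` acting on `J_a` by commutators
must match the curvature of `V` acting on the index `a`. -/
theorem commutator_curvature [T2Space M] (F : IsBiquardFrame S V g nabla O e η U) (hp : p ∈ O)
    (a : Fin 3) {X Y : VField n M} (hX : SmoothField X O) (hY : SmoothField Y O) :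
    S.J e (η a) p * curvFrame g nabla e X Y p - curvFrame g nabla e X Y p * S.J e (η a) p =
      ∑ b, curvFrame g nabla U X Y p a b • S.J e (η b) p := by
  have hb := dMat_mlieBracket F.isOpen hp (fun i j ↦ F.smooth_J a i j) hX hY (F.smooth_U 0)
    (F.U_ne_zero hp 0)
  rw [F.dMat_dMat_J hp a X hY, F.dMat_dMat_J hp a Y hX, F.dMat_J hp a (hX.mlieBracket F.isOpen hY)]
    at hb
  simp only [F.dMat_J hp _ hX, F.dMat_J hp _ hY] at hb
  exact commutator_of_second_derivative _ _ _ _ _ _ _ _ _ _ _ a hb.symm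

end IsBiquardFrame
end ParallelCurvature

/-! ### Orthogonality to `𝔱` and orthonormal triples in `𝔰𝔭₁`. -/

section QuaternionicStructure

open Matrix

/-- The elements of `B - ∑ J_k B J_k` commute with the quaternions. -/
theorem proj_commute {R : Type*} [Ring R] {I J K B : R} (hq : IsQuaternionTriple I J K) :
    (B - (I * B * I + J * B * J + K * B * K)) * I = I * (B - (I * B * I + J * B * J + K * B * K)) := by
  have e1 : I * B * I * I = -(I * B) := by rw [mul_assoc, hq.II]; simp
  have e2 : I * (I * B * I) = -(B * I) := by simp only [← mul_assoc, hq.II]; simp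
  have e3 : J * B * J * I = -(J * B * K) := by rw [mul_assoc, hq.JI]; simp
  have e4 : I * (J * B * J) = K * B * J := by simp only [← mul_assoc, hq.IJ]
  have e5 : K * B * K * I = K * B * J := by rw [mul_assoc, hq.KI]
  have e6 : I * (K * B * K) = -(J * B * K) := by simp only [← mul_assoc, hq.IK]; simp
  simp only [sub_mul, mul_sub, add_mul, mul_add, e1, e2, e3, e4, e5, e6]
  abel

variable {h : ℕ} {I J K B : Matrix (Fin h) (Fin h) ℝ}

/-- For the skew part `B`, the defect `D = B - ∑ J_k B J_k` is skew and commutes with the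
quaternions, so it lies in `𝔱₀` and `⟨D, B⟩ = 0`. Moving `J_k` past `D` gives `⟨D, J_k B J_k⟩ = -⟨D,
B⟩ = 0` too, hence `⟨D, D⟩ = 0`. -/
theorem skewPart_eq_of_inTPerpSym (hq : IsQuaternionTriple I J K) (hI : I.transpose = -I)
    (hJ : J.transpose = -J) (hK : K.transpose = -K)
    {sp : Submodule ℝ (Matrix (Fin h) (Fin h) ℝ)} (hsp : sp = Submodule.span ℝ {I, J, K})
    {T : Matrix (Fin h) (Fin h) ℝ} (hT : InTPerpSym sp T) :
    skewPart T = I * skewPart T * I + J * skewPart T * J + K * skewPart T * K := by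
  obtain ⟨B, S, hB, hBt, hS, rfl⟩ := hT
  have hBS : skewPart (B + S) = B := by
    simp only [skewPart, transpose_add, hB, hS]; module
  rw [hBS]
  set D := B - (I * B * I + J * B * J + K * B * K) with hD
  have DI : D * I = I * D := proj_commute hq
  have DJ : D * J = J * D := by
    have := proj_commute (B := B) hq.rotate
    rwa [← add_rotate, ← hD] at this
  have DK : D * K = K * D := by rw [← hq.IJ, ← mul_assoc, DI, mul_assoc, DJ, mul_assoc]
  have conj : ∀ L : Matrix (Fin h) (Fin h) ℝ, L.transpose = -L →
      (L * B * L).transpose = -(L * B * L) := fun L hL ↦ by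
    simp [transpose_mul, hL, hB, mul_assoc]
  have hDt : D.transpose = -D := by
    simp only [hD, transpose_sub, transpose_add, hB, conj I hI, conj J hJ, conj K hK]; abel
  have hDmem : D ∈ tAlg sp := by
    refine ⟨D, 0, hDt, fun L hL ↦ ?_, sp.zero_mem, by simp⟩
    rw [hsp] at hL
    induction hL using Submodule.span_induction with
    | mem x hx =>
      rcases hx with rfl | rfl | rfl
      · exact DI
      · exact DJ
      · exact DK
    | zero => simp
    | add x y _ _ hx hy => rw [mul_add, add_mul, hx, hy]
    | smul c x _ hx => rw [mul_smul_comm, smul_mul_assoc, hx]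
  have h0 : (D * B).trace = 0 := by
    have := hBt D hDmem
    rw [matInner, hDt, neg_mul, trace_neg, neg_eq_zero] at this
    exact this
  have tr : ∀ L : Matrix (Fin h) (Fin h) ℝ, L * L = -1 → D * L = L * D →
      (D * (L * B * L)).trace = 0 := fun L hL hDL ↦ by
    have : (D * (L * B * L)).trace = -(D * B).trace := by
      rw [← mul_assoc, trace_mul_comm, ← mul_assoc, ← mul_assoc, ← hDL, mul_assoc D, hL]
      simp
    rw [this, h0, neg_zero]
  have hDD : (D.transpose * D).trace = 0 := by
    rw [hDt]
    nth_rewrite 2 [hD]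
    simp [mul_sub, mul_add, h0, tr I hq.II DI, tr J hq.JJ DJ, tr K hq.KK DK]
  have hD0 : D = 0 := by
    rw [← conjTranspose_eq_transpose_of_trivial] at hDD
    exact trace_conjTranspose_mul_self_eq_zero_iff.1 hDD
  exact sub_eq_zero.1 hD0

/-- The skew part of `T` is orthogonal to `𝔰𝔭₁ ⊆ 𝔱`, and the symmetric part is orthogonal to every
skew matrix. -/
theorem trace_mul_eq_zero_of_inTPerpSym {sp : Submodule ℝ (Matrix (Fin h) (Fin h) ℝ)}
    (hI : I.transpose = -I) (hsp : I ∈ sp) {T : Matrix (Fin h) (Fin h) ℝ}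
    (hT : InTPerpSym sp T) : (I * T).trace = 0 := by
  obtain ⟨B, S, hB, hBt, hS, rfl⟩ := hT
  have h1 := hBt I ⟨0, I, by simp, by simp, hsp, by simp⟩
  rw [matInner, hI, neg_mul, trace_neg, neg_eq_zero] at h1
  have h2 : (I * S).trace = -(I * S).trace := by
    nth_rewrite 1 [← trace_transpose]
    rw [transpose_mul, hI, hS, mul_neg, trace_neg, trace_mul_comm]
  rw [mul_add, trace_add, h1]; linarith

/-- Three matrices in the span of a quaternion triple which are orthonormal for the normalized trace
form anticommute and square to `-1`. -/
theorem anticommutator_of_orthonormal (hh : (h : ℝ) ≠ 0) {K L : Fin 3 → Matrix (Fin h) (Fin h) ℝ}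
    (hK : ∀ a b, K a * K b + K b * K a = (-2 * delta a b) • (1 : Matrix (Fin h) (Fin h) ℝ))
    {P : Matrix (Fin 3) (Fin 3) ℝ}
    (hL : ∀ a, L a = ∑ b, P a b • K b) (htr : ∀ a b, (L a * L b).trace = -(h : ℝ) * delta a b)
    (a b : Fin 3) : L a * L b + L b * L a = (-2 * delta a b) • (1 : Matrix (Fin h) (Fin h) ℝ) := by
  -- By bilinearity the anticommutator is a scalar matrix; its trace, known from `htr`, then
  -- determines the scalar.
  have key : L a * L b + L b * L a =
      (-2 * ∑ c, P a c * P b c) • (1 : Matrix (Fin h) (Fin h) ℝ) := by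
    have e1 : L a * L b = ∑ c, ∑ d, (P a c * P b d) • (K c * K d) := by
      rw [hL a, hL b, Finset.sum_mul_sum]
      simp only [smul_mul_smul_comm]
    have e2 : L b * L a = ∑ c, ∑ d, (P a c * P b d) • (K d * K c) := by
      rw [hL a, hL b, Finset.sum_mul_sum, Finset.sum_comm]
      simp only [smul_mul_smul_comm, mul_comm]
    rw [e1, e2]
    simp only [← Finset.sum_add_distrib, ← smul_add, hK, smul_smul]
    simp only [← Finset.sum_smul]
    congr 1
    simp [delta, Finset.mul_sum]
    exact Finset.sum_congr rfl fun _ _ ↦ by ring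
  have ht := congrArg trace key
  rw [trace_add, htr, htr, trace_smul, trace_one, Fintype.card_fin, smul_eq_mul] at ht
  have hd : (delta b a : ℝ) = delta a b := by simp only [delta, eq_comm]
  rw [hd] at ht
  have : (∑ c, P a c * P b c) = delta a b := mul_right_cancel₀ hh (by linarith)
  rw [key, this]

end QuaternionicStructure

/-! ### An oriented orthonormal vertical frame induces a quaternion triple. -/

section QuaternionicFrames

open Matrix

set_option linter.unusedSectionVars false

variable {n h : ℕ} {M : Type*} [TopologicalSpace M]
  [ChartedSpace (EuclideanSpace ℝ (Fin n)) M] [IsManifold (𝓡 n) ∞ M]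
  {S : SubRiemannian n h M} {V : Distribution n M} {g : SubRiemannian.Metric n M}
  {nabla : Connection n M} {O : Set M} {e : Fin h → Π q : M, S.H q} {η : Fin 3 → OneForm n M}
  {U : Fin 3 → Π q : M, V q} {q p : M}

/-- In rank zero all horizontal brackets vanish, so bracket generation would make the tangent space
trivial and leave no nonzero covector. This permits division by `h`. -/
theorem rank_ne_zero (S : SubRiemannian n h M) {η : Fin 3 → OneForm n M} (hη : S.IsCoframe O η)
    (hq : q ∈ O) : h ≠ 0 := by
  rintro rfl
  have hH : ∀ (X : Π q : M, S.H q), toField X = 0 := by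
    intro X
    funext p
    have : FiniteDimensional ℝ (TangentSpace (𝓡 n) p) :=
      inferInstanceAs (FiniteDimensional ℝ (EuclideanSpace ℝ (Fin n)))
    have h0 : S.H p = ⊥ := Submodule.finrank_eq_zero.1 (S.smooth_H.1 p)
    exact (Submodule.mem_bot ℝ).1 (h0.le (X p).2)
  have htop := S.bracket_generating q
  have hle : Submodule.span ℝ {v : TangentSpace (𝓡 n) q | ∃ O : Set M, IsOpen O ∧ q ∈ O ∧
      ∃ X Y : Π q : M, S.H q, SmoothField (toField X) O ∧ SmoothField (toField Y) O ∧
      v = VectorField.mlieBracket (𝓡 n) (toField X) (toField Y) q} ≤ ⊥ := by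
    rw [Submodule.span_le]
    rintro v ⟨O', -, -, X, Y, -, -, rfl⟩
    rw [hH X]; simp
  rw [htop] at hle
  have h0 : η 0 q = 0 := by
    ext v
    have : v ∈ (⊥ : Submodule ℝ (TangentSpace (𝓡 n) q)) := hle trivial
    rw [(Submodule.mem_bot ℝ).1 this]; simp
  exact (hη.2 q hq).1.ne_zero 0 h0

namespace IsBiquardFrame

/-- Orthonormality of `U` makes the Gram matrix of the dual coframe the identity; the sign comes
from skewness of `J`. -/
theorem trace_J_mul_J (F : IsBiquardFrame S V g nabla O e η U) (hq : q ∈ O) (a b : Fin 3) :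
    (S.J e (η a) q * S.J e (η b) q).trace = -(h : ℝ) * delta a b := by
  have hh : (h : ℝ) ≠ 0 := by exact_mod_cast rank_ne_zero S F.coframe hq
  have h1 := F.biquard.extension.vertical O F.isOpen e η F.frame F.coframe q hq
    (fun a ↦ U a q) (F.dual.2 q hq)
  have h2 : (Matrix.of fun a b ↦ g.inner q (U a q) (U b q)) = (1 : Matrix (Fin 3) (Fin 3) ℝ) := by
    ext a b
    rw [of_apply, F.orthonormal q hq, one_apply]
  rw [h2, one_mul] at h1
  have h3 := congrFun (congrFun h1 b) a
  simp only [SubRiemannian.coGram, of_apply, matInner, F.J_skew hq, neg_mul, trace_neg,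
    one_apply] at h3
  have h4 : (delta a b : ℝ) = if b = a then 1 else 0 := by simp only [delta, eq_comm]
  rw [h4, ← h3]
  field_simp

/-- The contact hypothesis supplies a quaternionic triple for some other frame and coframe near `q`.
Changing the orthonormal frame of `H` conjugates that triple by an orthogonal `Q`, and changing the
coframe of `V^*` mixes it linearly by `P`. -/
theorem exists_quaternionTriple (F : IsBiquardFrame S V g nabla O e η U)
    (hqc : S.IsQuaternionicContact) (hq : q ∈ O) :
    ∃ (K : Fin 3 → Matrix (Fin h) (Fin h) ℝ) (P : Matrix (Fin 3) (Fin 3) ℝ),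
      IsQuaternionTriple (K 0) (K 1) (K 2) ∧ ∀ a, S.J e (η a) q = ∑ b, P a b • K b := by
  obtain ⟨O', hO', hq', e', η', he', hη', hquat⟩ := hqc q
  have hspan : ∀ a, ∃ c : Fin 3 → ℝ, ∀ v, η a q v = ∑ b, c b * η' b q v := by
    intro a
    -- Both coframes have `H` as common kernel, so each `η a` is pointwise a combination of the `η'
    -- b`.
    have hker : ⨅ b, (η' b q).toLinearMap.ker ≤ (η a q).toLinearMap.ker := by
      intro v hv
      simp only [Submodule.mem_iInf, LinearMap.mem_ker] at hv ⊢
      exact ((F.coframe.2 q hq).2 v).1 (((hη'.2 q hq').2 v).2 hv) a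
    obtain ⟨c, hc⟩ := (Submodule.mem_span_range_iff_exists_fun ℝ).1
      (mem_span_of_iInf_ker_le_ker hker)
    exact ⟨c, fun v ↦ by simpa using (congrArg (fun L ↦ L v) hc).symm⟩
  choose P hP using hspan
  have he'inner : ∀ i j, g.inner q (e' i q) (e' j q) = delta i j := fun i j ↦ by
    rw [F.biquard.extension.horizontal, he'.2 q hq']
  set Q : Matrix (Fin h) (Fin h) ℝ := Matrix.of fun k i ↦ g.inner q (e i q) (e' k q) with hQ
  have hexp : ∀ i, (e i q : TangentSpace (𝓡 n) q) = ∑ k, Q k i • (e' k q : TangentSpace (𝓡 n) q) :=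
    fun i ↦ expand_of_finrank (S.smooth_H.1 q) (f := fun i ↦ e' i q) he'inner (e i q).2
  have hQQ : Q.transpose * Q = 1 := by
    ext i j
    have := F.inner_e hq i j
    rw [hexp i, hexp j] at this
    simp [map_sum, he'inner, delta, -of_apply] at this
    rw [mul_apply, one_apply, ← this]
    exact Finset.sum_congr rfl fun k _ ↦ by simp [mul_comm]
  have hQQ' : Q * Q.transpose = 1 := mul_eq_one_comm.1 hQQ
  refine ⟨fun b ↦ Q.transpose * S.J e' (η' b) q * Q, P, ?_, fun a ↦ ?_⟩
  · have hmul : ∀ A B : Matrix (Fin h) (Fin h) ℝ, (Q.transpose * A * Q) * (Q.transpose * B * Q) =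
        Q.transpose * (A * B) * Q := fun A B ↦ by
      calc _ = Q.transpose * A * (Q * Q.transpose) * B * Q := by simp only [mul_assoc]
        _ = _ := by rw [hQQ']; simp only [mul_assoc, one_mul]
    have hneg : Q.transpose * (-1) * Q = -1 := by simp [hQQ]
    refine .of_mul_eq ?_ ?_ ?_ ?_
    · rw [hmul, (hquat q hq').1, hneg]
    · rw [hmul, (hquat q hq').1, hneg]
    · rw [hmul, (hquat q hq').1, hneg]
    · rw [hmul, hmul, (hquat q hq').2, hneg]
  · ext j i
    have hJ' : ∀ b k l, η' b q (nabla.torsion q (e' k q) (e' l q)) = S.J e' (η' b) q l k :=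
      fun b k l ↦ (dForm_eq_torsion F.biquard hO' hη' hq' b (he'.1 k) (he'.1 l)
        (fun q _ ↦ (e' k q).2) fun q _ ↦ (e' l q).2).symm
    rw [F.J_apply hq, ← F.eta_eq hq, hP, hexp i, hexp j]
    simp only [map_sum, map_smul, _root_.sum_apply, hJ', _root_.smul_apply,
      smul_eq_mul, Matrix.sum_apply, Matrix.smul_apply, mul_apply, transpose_apply,
      Finset.sum_mul]
    refine Finset.sum_congr rfl fun b _ ↦ ?_
    simp only [Finset.mul_sum]
    rw [Finset.sum_comm]
    exact Finset.sum_congr rfl fun k _ ↦ Finset.sum_congr rfl fun l _ ↦ by ring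

/-- In the span of a quaternion triple, orthonormality already forces each `J_a` to square to `-1`;
the orientation hypothesis completes the multiplication table. -/
theorem quaternionTriple (F : IsBiquardFrame S V g nabla O e η U)
    (hqc : S.IsQuaternionicContact) (hq : q ∈ O)
    (hor : S.J e (η 0) q * S.J e (η 1) q * S.J e (η 2) q = -1) :
    IsQuaternionTriple (S.J e (η 0) q) (S.J e (η 1) q) (S.J e (η 2) q) := by
  have hh : (h : ℝ) ≠ 0 := by exact_mod_cast rank_ne_zero S F.coframe hq
  obtain ⟨K, P, hK, hJ⟩ := F.exists_quaternionTriple hqc hq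
  have hKK : ∀ a b, K a * K b + K b * K a =
      (-2 * delta a b) • (1 : Matrix (Fin h) (Fin h) ℝ) := by
    intro a b
    fin_cases a <;> fin_cases b <;>
      simp [delta, hK.II, hK.JJ, hK.KK, hK.IJ, hK.JI, hK.JK, hK.KJ, hK.IK, hK.KI] <;> module
  have hJJ := anticommutator_of_orthonormal hh hKK hJ (F.trace_J_mul_J hq)
  have hsq : ∀ a, S.J e (η a) q * S.J e (η a) q = -1 := fun a ↦ by
    have := hJJ a a
    rw [← two_smul ℝ] at this
    refine smul_right_injective _ (two_ne_zero' ℝ) (this.trans ?_)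
    simp
  exact .of_mul_eq (hsq 0) (hsq 1) (hsq 2) hor

end IsBiquardFrame
end QuaternionicFrames

/-! ### Brackets in the frame, and the Bianchi identity on two horizontal vectors and one vertical
vector. -/

section TorsionConstraint

open VectorField

set_option linter.unusedSectionVars false

variable {n h : ℕ} {M : Type*} [TopologicalSpace M]
  [ChartedSpace (EuclideanSpace ℝ (Fin n)) M] [IsManifold (𝓡 n) ∞ M]

theorem curvMatrix_skew {ι : Type*} [Fintype ι] {g : SubRiemannian.Metric n M}
    {nabla : Connection n M} {f : ι → VField n M} {O : Set M} {p : M} (hO : IsOpen O)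
    (hskew : ∀ q ∈ O, ∀ v, (conMatrix g nabla f q v).transpose = -conMatrix g nabla f q v)
    (hp : p ∈ O) (X Y : VField n M) :
    (curvMatrix g nabla f X Y p).transpose = -curvMatrix g nabla f X Y p := by
  have hd : ∀ X Y : VField n M, (dMat (fun q ↦ conMatrix g nabla f q (Y q)) p (X p)).transpose =
      -dMat (fun q ↦ conMatrix g nabla f q (Y q)) p (X p) := by
    intro X Y
    have h1 : (dMat (fun q ↦ conMatrix g nabla f q (Y q)) p (X p)).transpose =
        dMat (fun q ↦ (conMatrix g nabla f q (Y q)).transpose) p (X p) := rfl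
    rw [h1, dMat_congr hO hp fun q hq ↦ hskew q hq (Y q), dMat_neg]
  simp only [curvMatrix, Matrix.transpose_sub, Matrix.transpose_add, Matrix.transpose_mul, hd,
    hskew p hp]
  noncomm_ring

namespace IsBiquardFrame

variable {S : SubRiemannian n h M} {V : Distribution n M} {g : SubRiemannian.Metric n M}
  {nabla : Connection n M} {O : Set M} {e : Fin h → Π q : M, S.H q} {η : Fin 3 → OneForm n M}
  {U : Fin 3 → Π q : M, V q} {q p : M}

theorem inner_eU (F : IsBiquardFrame S V g nabla O e η U) (i : Fin h) (a : Fin 3) :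
    g.inner q (e i q) (U a q) = 0 := F.inner_HV (e i q).2 (U a q).2

theorem inner_Ue (F : IsBiquardFrame S V g nabla O e η U) (i : Fin h) (a : Fin 3) :
    g.inner q (U a q) (e i q) = 0 := F.inner_VH (e i q).2 (U a q).2

theorem mlieBracket_eq (F : IsBiquardFrame S V g nabla O e η U) (hq : q ∈ O) {X Y : VField n M}
    (hX : SmoothField X O) (hY : SmoothField Y O) : mlieBracket (𝓡 n) X Y q =
      nabla Y q (X q) - nabla X q (Y q) - nabla.torsion q (X q) (Y q) := by
  rw [Connection.torsion_eq F.isOpen hq hX hY]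
  simp only [Connection.along]
  abel

theorem bracket_eU (F : IsBiquardFrame S V g nabla O e η U) (hq : q ∈ O) (j : Fin h) (a : Fin 3) :
    mlieBracket (𝓡 n) (toField (e j)) (toField (U a)) q =
      ∑ c, conFrame g nabla U q (e j q) c a • (U c q : TangentSpace (𝓡 n) q) +
      ∑ k, (S.torMatrix g nabla e q (U a q) - conFrame g nabla e q (U a q)) k j •
        (e k q : TangentSpace (𝓡 n) q) := by
  rw [F.mlieBracket_eq hq (F.smooth_e j) (F.smooth_U a), F.nabla_e hq, F.nabla_U hq,
    show nabla.torsion q (toField (e j) q) (toField (U a) q) = _ from F.torsion_eU hq a j]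
  simp only [Matrix.sub_apply, sub_smul, Finset.sum_sub_distrib]
  abel

theorem bracket_Ue (F : IsBiquardFrame S V g nabla O e η U) (hq : q ∈ O) (j : Fin h) (a : Fin 3) :
    mlieBracket (𝓡 n) (toField (U a)) (toField (e j)) q =
      -(∑ c, conFrame g nabla U q (e j q) c a • (U c q : TangentSpace (𝓡 n) q) +
      ∑ k, (S.torMatrix g nabla e q (U a q) - conFrame g nabla e q (U a q)) k j •
        (e k q : TangentSpace (𝓡 n) q)) := by
  rw [mlieBracket_swap_apply, F.bracket_eU hq]

theorem bracket_ee (F : IsBiquardFrame S V g nabla O e η U) (hq : q ∈ O) (i j : Fin h) :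
    mlieBracket (𝓡 n) (toField (e i)) (toField (e j)) q =
      ∑ k, (conFrame g nabla e q (e i q) k j - conFrame g nabla e q (e j q) k i) •
        (e k q : TangentSpace (𝓡 n) q) -
      ∑ c, S.J e (η c) q j i • (U c q : TangentSpace (𝓡 n) q) := by
  rw [F.mlieBracket_eq hq (F.smooth_e i) (F.smooth_e j), F.nabla_e hq, F.nabla_e hq,
    show nabla.torsion q (toField (e i) q) (toField (e j) q) = _ from F.torsion_ee hq i j]
  simp only [sub_smul, Finset.sum_sub_distrib]

theorem bracket_UU (F : IsBiquardFrame S V g nabla O e η U) (hV : IsInvolutive V) (hq : q ∈ O)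
    (a b : Fin 3) :
    mlieBracket (𝓡 n) (toField (U a)) (toField (U b)) q =
      ∑ c, (conFrame g nabla U q (U a q) c b - conFrame g nabla U q (U b q) c a
        - vertTor g nabla U q a b c) • (U c q : TangentSpace (𝓡 n) q) := by
  rw [F.mlieBracket_eq hq (F.smooth_U a) (F.smooth_U b), F.nabla_U hq, F.nabla_U hq,
    show nabla.torsion q (toField (U a) q) (toField (U b) q) = _ from F.torsion_UU hV hq a b]
  simp only [sub_smul, Finset.sum_sub_distrib]

theorem curvature_e [T2Space M] (F : IsBiquardFrame S V g nabla O e η U) (hp : p ∈ O)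
    {X Y : VField n M} (hX : SmoothField X O) (hY : SmoothField Y O) (i : Fin h) :
    nabla.curvature X Y (toField (e i)) p =
      ∑ k, curvFrame g nabla e X Y p k i • (e k p : TangentSpace (𝓡 n) p) :=
  curvature_frame F.biquard.smooth F.isOpen hp F.smooth_e (fun _ hq ↦ F.nabla_e hq) hX hY i

theorem curvature_U [T2Space M] (F : IsBiquardFrame S V g nabla O e η U) (hp : p ∈ O)
    {X Y : VField n M} (hX : SmoothField X O) (hY : SmoothField Y O) (a : Fin 3) :
    nabla.curvature X Y (toField (U a)) p =
      ∑ c, curvFrame g nabla U X Y p c a • (U c p : TangentSpace (𝓡 n) p) :=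
  curvature_frame F.biquard.smooth F.isOpen hp F.smooth_U (fun _ hq ↦ F.nabla_U hq) hX hY a

theorem inner_sum_U (F : IsBiquardFrame S V g nabla O e η U) (hq : q ∈ O) (c : Fin 3 → ℝ)
    (b : Fin 3) : g.inner q (∑ a, c a • (U a q : TangentSpace (𝓡 n) q)) (U b q) = c b := by
  simp [map_sum, F.orthonormal q hq, delta]

theorem inner_sum_e (F : IsBiquardFrame S V g nabla O e η U) (hq : q ∈ O) (c : Fin h → ℝ)
    (j : Fin h) : g.inner q (∑ i, c i • (e i q : TangentSpace (𝓡 n) q)) (e j q) = c j := by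
  simp [map_sum, F.inner_e hq, delta]

theorem inner_sum_e_U (F : IsBiquardFrame S V g nabla O e η U) (c : Fin h → ℝ)
    (b : Fin 3) : g.inner q (∑ i, c i • (e i q : TangentSpace (𝓡 n) q)) (U b q) = 0 := by
  simp [map_sum, F.inner_eU]

theorem inner_sum_U_e (F : IsBiquardFrame S V g nabla O e η U) (c : Fin 3 → ℝ)
    (j : Fin h) : g.inner q (∑ a, c a • (U a q : TangentSpace (𝓡 n) q)) (e j q) = 0 := by
  simp [map_sum, F.inner_Ue]

/-- The curvature of `V` in horizontal directions, in terms of the torsion. -/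
theorem curvFrame_horizontal [T2Space M] (F : IsBiquardFrame S V g nabla O e η U)
    (hV : IsInvolutive V) (hp : p ∈ O) (a b : Fin 3) (i j : Fin h) :
    curvFrame g nabla U (toField (e i)) (toField (e j)) p b a =
      (S.J e (η b) p * S.torMatrix g nabla e p (U a p)
        + (S.torMatrix g nabla e p (U a p)).transpose * S.J e (η b) p
        + ∑ c, vertTor g nabla U p c a b • S.J e (η c) p) j i := by
  have hO := F.isOpen
  have hn := F.biquard.smooth
  have hb := Connection.first_bianchi hn hO hp (F.smooth_e i) (F.smooth_e j) (F.smooth_U a)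
  rw [F.curvature_U hp (F.smooth_e i) (F.smooth_e j), F.curvature_e hp (F.smooth_e j) (F.smooth_U a),
    F.curvature_e hp (F.smooth_U a) (F.smooth_e i)] at hb
  have hb := congrArg (fun v ↦ g.inner p v (U b p)) hb
  simp only [map_add, _root_.add_apply, F.inner_sum_U hp, F.inner_sum_e_U] at hb
  -- `Tor(H, V)` is horizontal and `H` is parallel, so this derivative and the next have no vertical
  -- component.
  have t1 : g.inner p (nabla (nabla.torField (toField (e j)) (toField (U a))) p (e i p)) (U b p)
      = 0 := F.inner_HV (F.nabla_mem_H hp (.torField hn hO (F.smooth_e j) (F.smooth_U a))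
        (fun q hq ↦ F.biquard.torsion_HV q _ (e j q).2 _ (U a q).2) _) (U b p).2
  have t2 : g.inner p (nabla (nabla.torField (toField (U a)) (toField (e i))) p (e j p)) (U b p)
      = 0 := F.inner_HV (F.nabla_mem_H hp (.torField hn hO (F.smooth_U a) (F.smooth_e i))
        (fun q hq ↦ F.torsion_mem_H (U a q).2 (e i q).2) _) (U b p).2
  -- Differentiating `∑ J_c U_c`: the terms from `∇ U_c` cancel the vertical connection terms of
  -- `dMat_J`.
  have t3 : g.inner p (nabla (nabla.torField (toField (e i)) (toField (e j))) p (U a p)) (U b p)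
      = (S.J e (η b) p * conFrame g nabla e p (U a p)
        - conFrame g nabla e p (U a p) * S.J e (η b) p) j i := by
    rw [nabla.congr hO (.torField hn hO (F.smooth_e i) (F.smooth_e j))
      (Y' := fun q ↦ ∑ c, S.J e (η c) q j i • toField (U c) q) (fun q hq ↦ F.torsion_ee hq i j) hp,
      Connection.sum_smul_apply hO hp Finset.univ (fun c _ ↦ F.smooth_J c j i)
        fun c _ ↦ F.smooth_U c]
    have hd : dFun (n := n) (fun q ↦ S.J e (η b) q j i) p (U a p) =
        (-∑ c, conFrame g nabla U p (U a p) b c • S.J e (η c) p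
          + S.J e (η b) p * conFrame g nabla e p (U a p)
          - conFrame g nabla e p (U a p) * S.J e (η b) p) j i :=
      congrFun (congrFun (F.dMat_J hp b (F.smooth_U a)) j) i
    rw [Finset.sum_add_distrib, map_add, _root_.add_apply, F.inner_sum_U hp]
    simp only [F.nabla_U hp, map_sum, map_smul, _root_.sum_apply, _root_.smul_apply,
      F.orthonormal p hp, smul_eq_mul, delta, mul_ite, mul_one, mul_zero, Finset.sum_ite_eq',
      Finset.mem_univ, if_true]
    rw [hd]
    simp only [Matrix.sub_apply, Matrix.add_apply, Matrix.neg_apply, Matrix.sum_apply,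
      Matrix.smul_apply, smul_eq_mul]
    simp only [mul_comm (S.J e _ p j i)]
    ring
  have t4 : g.inner p (nabla.torsion p (e i p)
      (mlieBracket (𝓡 n) (toField (e j)) (toField (U a)) p)) (U b p) =
      ∑ k, (S.torMatrix g nabla e p (U a p) - conFrame g nabla e p (U a p)) k j
        * S.J e (η b) p k i := by
    rw [F.bracket_eU hp]
    simp only [map_add, map_sum, map_smul, F.torsion_eU hp, F.torsion_ee hp, map_neg,
      _root_.add_apply, _root_.sum_apply, _root_.smul_apply, _root_.neg_apply, F.inner_eU,
      F.orthonormal p hp]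
    simp [delta]
  have t5 : g.inner p (nabla.torsion p (e j p)
      (mlieBracket (𝓡 n) (toField (U a)) (toField (e i)) p)) (U b p) =
      -∑ k, (S.torMatrix g nabla e p (U a p) - conFrame g nabla e p (U a p)) k i
        * S.J e (η b) p k j := by
    rw [F.bracket_Ue hp]
    simp only [map_add, map_sum, map_smul, F.torsion_eU hp, F.torsion_ee hp, map_neg,
      _root_.add_apply, _root_.sum_apply, _root_.smul_apply, _root_.neg_apply, F.inner_eU,
      F.orthonormal p hp]
    simp [delta]
  have t6 : g.inner p (nabla.torsion p (U a p)
      (mlieBracket (𝓡 n) (toField (e i)) (toField (e j)) p)) (U b p) =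
      -∑ c, S.J e (η c) p j i * vertTor g nabla U p a c b := by
    rw [F.bracket_ee hp]
    simp only [map_sub, map_sum, map_smul, F.torsion_Ue hp, F.torsion_UU hV hp,
      _root_.sub_apply, _root_.sum_apply, _root_.smul_apply, F.inner_eU,
      F.orthonormal p hp]
    simp [delta]
  erw [t1, t2, t3, t4, t5, t6] at hb
  -- Skewness of `J_b` and of the horizontal connection matrix puts all sums in matrix-product form,
  -- where the connection terms of `t3`, `t4` and `t5` cancel.
  have hJ : ∀ k, S.J e (η b) p k j = -S.J e (η b) p j k := fun k ↦
    congrFun (congrFun (F.J_skew hp b) j) k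
  have hw : ∀ k, conFrame g nabla e p (U a p) k j = -conFrame g nabla e p (U a p) j k := fun k ↦
    congrFun (congrFun (F.skew_e hp (U a p)) j) k
  have hc : ∀ c, vertTor g nabla U p a c b = -vertTor g nabla U p c a b := fun c ↦
    vertTor_antisymm a c b
  simp only [add_zero, zero_add, Matrix.sub_apply, hJ, hc, hw, sub_mul, Finset.sum_sub_distrib, mul_neg,
    sub_neg_eq_add, Finset.sum_neg_distrib, neg_neg, Matrix.mul_apply] at hb
  simp only [add_mul, Finset.sum_add_distrib] at hb
  rw [hb]
  simp only [Matrix.add_apply, Matrix.sum_apply, Matrix.smul_apply, Matrix.mul_apply,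
    Matrix.transpose_apply, smul_eq_mul]
  simp only [mul_comm (S.J e _ p j _)]
  ring

end IsBiquardFrame
end TorsionConstraint

/-! ### Traces of the symmetrized constraint. -/

section TraceConstraint

open Matrix

variable {h : ℕ} {J : Fin 3 → Matrix (Fin h) (Fin h) ℝ}

/-- A product `J_a J_b` is `-1` if `a = b` and otherwise plus or minus the third unit, against which
`X` has zero trace. -/
theorem trace_quaternion_mul (hq : IsQuaternionTriple (J 0) (J 1) (J 2))
    {X : Matrix (Fin h) (Fin h) ℝ} (hX : ∀ a, (J a * X).trace = 0) (a b : Fin 3) :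
    (J a * J b * X).trace = -delta a b * X.trace := by
  have h0 := hX 0
  have h1 := hX 1
  have h2 := hX 2
  fin_cases a <;> fin_cases b <;>
    simp [delta, hq.II, hq.JJ, hq.KK, hq.IJ, hq.JI, hq.JK, hq.KJ, hq.IK, hq.KI, h0, h1, h2]

/-- The vertical torsion components are totally antisymmetric. -/
theorem antisymm_of_constraint (hh : (h : ℝ) ≠ 0) (hq : IsQuaternionTriple (J 0) (J 1) (J 2))
    (hJ : ∀ a, (J a).transpose = -J a) (hJJ : ∀ a b, (J a * J b).trace = -(h : ℝ) * delta a b)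
    {T : Fin 3 → Matrix (Fin h) (Fin h) ℝ} (hT : ∀ a b, (J a * T b).trace = 0)
    {t : Fin 3 → Fin 3 → Fin 3 → ℝ} (ht : ∀ a b c, t a b c = -t b a c)
    (hC : ∀ a b, J b * T a + (T a).transpose * J b + ∑ c, t c a b • J c =
      -(J a * T b + (T b).transpose * J a + ∑ c, t c b a • J c)) (a b c : Fin 3) :
    t c a b = -t c b a := by
  have hflip : ∀ a b c, (J c * (T a).transpose * J b).trace = (J c * J b * T a).trace := by
    intro a b c
    rw [← trace_transpose, transpose_mul, transpose_mul, transpose_transpose, hJ, hJ, neg_mul,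
      mul_neg, mul_neg, neg_neg, trace_mul_comm, trace_mul_comm (J c * J b), mul_assoc]
  -- Pairing the constraint with `J_c`: both torsion products contribute the same trace by `hflip`,
  -- and the `J`-sum contributes a single component of `t`.
  have key : ∀ a b c, -2 * delta c b * (T a).trace - (h : ℝ) * t c a b =
      -(-2 * delta c a * (T b).trace - (h : ℝ) * t c b a) := by
    intro a b c
    have := congrArg (fun X ↦ (J c * X).trace) (hC a b)
    simp only [mul_neg, trace_neg, mul_add, trace_add, hflip, ← mul_assoc,
      trace_quaternion_mul hq (fun d ↦ hT d _), Finset.mul_sum, mul_smul_comm, trace_sum,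
      trace_smul, hJJ, smul_eq_mul] at this
    simp only [delta, mul_ite, mul_one, mul_zero, Finset.sum_ite_eq, Finset.mem_univ, if_true]
      at this
    simp only [delta]
    linarith
  -- With all indices equal the component of `t` vanishes and only the trace of `T_a` is left.
  have htr : ∀ a, (T a).trace = 0 := fun a ↦ by
    have h1 := key a a a
    have h2 : t a a a = 0 := by have := ht a a a; linarith
    rw [h2] at h1
    simp only [delta, if_true] at h1
    linarith
  have h1 := key a b c
  rw [htr, htr] at h1
  exact mul_left_cancel₀ hh (by linarith)

theorem trace_mul_sub_sum {I A B X Y : Matrix (Fin h) (Fin h) ℝ} (hA : (I * A).trace = 0)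
    (hB : (I * B).trace = 0) {T : Fin 3 → Matrix (Fin h) (Fin h) ℝ}
    (hT : ∀ d, (I * T d).trace = 0) {f : Fin 3 → ℝ} :
    (I * (A - B - (X - Y) - ∑ d, f d • T d)).trace = (I * (Y - X)).trace := by
  simp only [mul_sub, trace_sub, Finset.mul_sum, mul_smul_comm, trace_sum, trace_smul, hA, hB, hT,
    smul_zero, Finset.sum_const_zero]
  ring

end TraceConstraint

/-! ### The Bianchi identity on two vertical vectors and one horizontal vector, and its traces. -/

section VerticalCurvature

open VectorField

set_option linter.unusedSectionVars false

variable {n h : ℕ} {M : Type*} [TopologicalSpace M]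
  [ChartedSpace (EuclideanSpace ℝ (Fin n)) M] [IsManifold (𝓡 n) ∞ M]
  {S : SubRiemannian n h M} {V : Distribution n M} {g : SubRiemannian.Metric n M}
  {nabla : Connection n M} {O : Set M} {e : Fin h → Π q : M, S.H q} {η : Fin 3 → OneForm n M}
  {U : Fin 3 → Π q : M, V q} {q p : M}

theorem Connection.neg_apply (hO : IsOpen O) (hp : p ∈ O) {X : VField n M} (hX : SmoothField X O)
    (v : TangentSpace (𝓡 n) p) : nabla (-X) p v = -nabla X p v := by
  have hX' : SmoothField (-X) O := (hX.sub (hX.add hX)).congr fun q _ ↦ by simp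
  have h := Connection.sub_apply (nabla := nabla) hO hp hX (hX.add hX) v
  rw [Connection.add_apply hO hp hX hX, show X - (X + X) = -X by abel] at h
  rw [h]; abel

namespace IsBiquardFrame

theorem trace_J_mul_T (F : IsBiquardFrame S V g nabla O e η U) (hq : q ∈ O) (a b : Fin 3) :
    (S.J e (η a) q * S.torMatrix g nabla e q (U b q)).trace = 0 :=
  trace_mul_eq_zero_of_inTPerpSym (F.J_skew hq a) (Submodule.subset_span (Set.mem_range_self (f := fun a ↦ S.J e (η a) q) a))
    (F.biquard.torsion_V O F.isOpen e η F.frame F.coframe q hq (U b q) (U b q).2)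

/-- Skew-symmetry of the curvature of `V`, a consequence of `∇ g = 0`, transcribed through
`curvFrame_horizontal`. -/
theorem horizontal_constraint [T2Space M] (F : IsBiquardFrame S V g nabla O e η U)
    (hV : IsInvolutive V) (hq : q ∈ O) (a b : Fin 3) :
    S.J e (η b) q * S.torMatrix g nabla e q (U a q)
        + (S.torMatrix g nabla e q (U a q)).transpose * S.J e (η b) q
        + ∑ c, vertTor g nabla U q c a b • S.J e (η c) q =
      -(S.J e (η a) q * S.torMatrix g nabla e q (U b q)
        + (S.torMatrix g nabla e q (U b q)).transpose * S.J e (η a) q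
        + ∑ c, vertTor g nabla U q c b a • S.J e (η c) q) := by
  ext j i
  rw [Matrix.neg_apply, ← F.curvFrame_horizontal hV hq, ← F.curvFrame_horizontal hV hq]
  exact congrFun (congrFun (curvMatrix_skew F.isOpen (fun q hq ↦ F.skew_U hq) hq _ _) a) b

theorem vertTor_antisymm_right [T2Space M] (F : IsBiquardFrame S V g nabla O e η U)
    (hV : IsInvolutive V) (hq : q ∈ O)
    (hquat : IsQuaternionTriple (S.J e (η 0) q) (S.J e (η 1) q) (S.J e (η 2) q)) (a b c : Fin 3) :
    vertTor g nabla U q a b c = -vertTor g nabla U q a c b :=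
  antisymm_of_constraint (J := fun a ↦ S.J e (η a) q)
    (T := fun a ↦ S.torMatrix g nabla e q (U a q))
    (by exact_mod_cast rank_ne_zero S F.coframe hq) hquat (F.J_skew hq)
    (F.trace_J_mul_J hq) (F.trace_J_mul_T hq) vertTor_antisymm (F.horizontal_constraint hV hq) b c a

/-- Total antisymmetry of the vertical torsion removes the `J`-sums from `horizontal_constraint`. -/
theorem torsion_constraint [T2Space M] (F : IsBiquardFrame S V g nabla O e η U)
    (hV : IsInvolutive V) (hq : q ∈ O)
    (hquat : IsQuaternionTriple (S.J e (η 0) q) (S.J e (η 1) q) (S.J e (η 2) q)) (a b : Fin 3) :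
    S.J e (η b) q * S.torMatrix g nabla e q (U a q)
        + (S.torMatrix g nabla e q (U a q)).transpose * S.J e (η b) q
        + (S.J e (η a) q * S.torMatrix g nabla e q (U b q)
        + (S.torMatrix g nabla e q (U b q)).transpose * S.J e (η a) q) = 0 := by
  have h1 := F.horizontal_constraint hV hq a b
  have h2 : ∑ c, vertTor g nabla U q c a b • S.J e (η c) q =
      -∑ c, vertTor g nabla U q c b a • S.J e (η c) q := by
    rw [← Finset.sum_neg_distrib]
    refine Finset.sum_congr rfl fun c _ ↦ ?_
    rw [F.vertTor_antisymm_right hV hq hquat c a b, neg_smul]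
  rw [h2] at h1
  rw [← sub_eq_zero] at h1
  rw [← h1]
  abel

theorem torsion_diagonal [T2Space M] (F : IsBiquardFrame S V g nabla O e η U)
    (hV : IsInvolutive V) (hq : q ∈ O)
    (hquat : IsQuaternionTriple (S.J e (η 0) q) (S.J e (η 1) q) (S.J e (η 2) q)) (a : Fin 3) :
    S.J e (η a) q * S.torMatrix g nabla e q (U a q)
        + (S.torMatrix g nabla e q (U a q)).transpose * S.J e (η a) q = 0 := by
  have h1 := F.torsion_constraint hV hq hquat a a
  rw [← two_smul ℝ] at h1
  exact (smul_eq_zero.1 h1).resolve_left two_ne_zero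

/-- The curvature of `H` in vertical directions, in terms of the torsion. -/
theorem curvFrame_vertical [T2Space M] (F : IsBiquardFrame S V g nabla O e η U)
    (hV : IsInvolutive V) (hp : p ∈ O) (c a : Fin 3) :
    curvFrame g nabla e (toField (U c)) (toField (U a)) p =
      (dMat (n := n) (fun q ↦ S.torMatrix g nabla e q (U a q)) p (U c p)
          + conFrame g nabla e p (U c p) * S.torMatrix g nabla e p (U a p)
          - S.torMatrix g nabla e p (U a p) * conFrame g nabla e p (U c p))
        - (dMat (n := n) (fun q ↦ S.torMatrix g nabla e q (U c q)) p (U a p)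
          + conFrame g nabla e p (U a p) * S.torMatrix g nabla e p (U c p)
          - S.torMatrix g nabla e p (U c p) * conFrame g nabla e p (U a p))
        - (S.torMatrix g nabla e p (U c p) * S.torMatrix g nabla e p (U a p)
          - S.torMatrix g nabla e p (U a p) * S.torMatrix g nabla e p (U c p))
        - ∑ d, (conFrame g nabla U p (U c p) d a - conFrame g nabla U p (U a p) d c
          - vertTor g nabla U p c a d) • S.torMatrix g nabla e p (U d p) := by
  ext j i
  have hO := F.isOpen
  have hn := F.biquard.smooth
  have hb := Connection.first_bianchi hn hO hp (F.smooth_U c) (F.smooth_U a) (F.smooth_e i)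
  rw [F.curvature_e hp (F.smooth_U c) (F.smooth_U a), F.curvature_U hp (F.smooth_U a) (F.smooth_e i),
    F.curvature_U hp (F.smooth_e i) (F.smooth_U c)] at hb
  have hb := congrArg (fun v ↦ g.inner p v (e j p)) hb
  simp only [map_add, _root_.add_apply, F.inner_sum_e hp, F.inner_sum_U_e] at hb
  have dT : ∀ c a : Fin 3, g.inner p (nabla (nabla.torField (toField (U a)) (toField (e i))) p
      (U c p)) (e j p) =
      (dMat (n := n) (fun q ↦ S.torMatrix g nabla e q (U a q)) p (U c p)
          + conFrame g nabla e p (U c p) * S.torMatrix g nabla e p (U a p)) j i := by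
    intro c a
    rw [nabla.congr hO (.torField hn hO (F.smooth_U a) (F.smooth_e i))
      (Y' := fun q ↦ ∑ k, S.torMatrix g nabla e q (U a q) k i • toField (e k) q)
      (fun q hq ↦ F.torsion_Ue hq a i) hp,
      Connection.sum_smul_apply hO hp Finset.univ (fun k _ ↦ F.smooth_T a k i)
        fun k _ ↦ F.smooth_e k]
    rw [Finset.sum_add_distrib, map_add, _root_.add_apply, F.inner_sum_e hp]
    simp only [F.nabla_e hp, map_sum, map_smul, _root_.sum_apply, _root_.smul_apply,
      F.inner_e hp, smul_eq_mul, delta, mul_ite, mul_one, mul_zero, Finset.sum_ite_eq',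
      Finset.mem_univ, if_true]
    rw [Matrix.add_apply, Matrix.mul_apply, add_comm]
    simp only [mul_comm (S.torMatrix g nabla e p (U a p) _ i)]
    rfl
  have t2 : g.inner p (nabla (nabla.torField (toField (e i)) (toField (U c))) p (U a p)) (e j p) =
      -(dMat (n := n) (fun q ↦ S.torMatrix g nabla e q (U c q)) p (U a p)
          + conFrame g nabla e p (U a p) * S.torMatrix g nabla e p (U c p)) j i := by
    rw [← dT, nabla.congr hO (.torField hn hO (F.smooth_e i) (F.smooth_U c))
      (Y' := -nabla.torField (toField (U c)) (toField (e i)))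
      (fun q _ ↦ nabla.torsion_antisymm _ _) hp,
      Connection.neg_apply hO hp (.torField hn hO (F.smooth_U c) (F.smooth_e i)), map_neg,
      _root_.neg_apply]
  -- The torsion of two vertical vectors is vertical and `V` is parallel, so there is no horizontal
  -- component.
  have t3 : g.inner p (nabla (nabla.torField (toField (U c)) (toField (U a))) p (e i p)) (e j p)
      = 0 := by
    refine F.inner_VH (e j p).2 (F.nabla_mem_V hp (.torField hn hO (F.smooth_U c) (F.smooth_U a))
      (fun q hq ↦ ?_) _)
    rw [show nabla.torField (toField (U c)) (toField (U a)) q = _ from F.torsion_UU hV hq c a]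
    exact (V q).sum_mem fun d _ ↦ (V q).smul_mem _ (U d q).2
  have t4 : g.inner p (nabla.torsion p (U c p)
      (mlieBracket (𝓡 n) (toField (U a)) (toField (e i)) p)) (e j p) =
      -∑ k, (S.torMatrix g nabla e p (U a p) - conFrame g nabla e p (U a p)) k i
        * S.torMatrix g nabla e p (U c p) j k := by
    rw [F.bracket_Ue hp]
    simp only [map_add, map_sum, map_smul, F.torsion_Ue hp, F.torsion_UU hV hp, map_neg,
      _root_.add_apply, _root_.sum_apply, _root_.smul_apply, _root_.neg_apply, F.inner_Ue,
      F.inner_e hp]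
    simp [delta]
  have t5 : g.inner p (nabla.torsion p (U a p)
      (mlieBracket (𝓡 n) (toField (e i)) (toField (U c)) p)) (e j p) =
      ∑ k, (S.torMatrix g nabla e p (U c p) - conFrame g nabla e p (U c p)) k i
        * S.torMatrix g nabla e p (U a p) j k := by
    rw [F.bracket_eU hp]
    simp only [map_add, map_sum, map_smul, F.torsion_Ue hp, F.torsion_UU hV hp,
      _root_.add_apply, _root_.sum_apply, _root_.smul_apply, F.inner_Ue,
      F.inner_e hp]
    simp [delta]
  have t6 : g.inner p (nabla.torsion p (e i p)
      (mlieBracket (𝓡 n) (toField (U c)) (toField (U a)) p)) (e j p) =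
      -∑ d, (conFrame g nabla U p (U c p) d a - conFrame g nabla U p (U a p) d c
          - vertTor g nabla U p c a d) * S.torMatrix g nabla e p (U d p) j i := by
    rw [F.bracket_UU hV hp]
    simp only [map_sum, map_smul, F.torsion_eU hp, map_neg,
      _root_.sum_apply, _root_.smul_apply, _root_.neg_apply, F.inner_e hp]
    simp [delta]
  erw [dT, t2, t3, t4, t5, t6] at hb
  simp only [add_zero] at hb
  rw [hb]
  simp only [Matrix.sub_apply, Matrix.add_apply, Matrix.mul_apply, Matrix.sum_apply,
    Matrix.smul_apply, smul_eq_mul, sub_mul, Finset.sum_sub_distrib]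
  simp only [mul_comm (S.torMatrix g nabla e p _ j _)]
  ring

/-- Differentiate `tr(J_b T_a) = 0`. The `V`-connection terms in the derivative of `J_b` are
combinations of the `J_c`, again orthogonal to `T_a`, and cyclicity moves the `H`-connection terms
onto `T_a`. -/
theorem trace_J_derivative [T2Space M] (F : IsBiquardFrame S V g nabla O e η U) (hp : p ∈ O)
    (a b : Fin 3) {Z : VField n M} (hZ : SmoothField Z O) :
    (S.J e (η b) p * (dMat (n := n) (fun q ↦ S.torMatrix g nabla e q (U a q)) p (Z p)
          + conFrame g nabla e p (Z p) * S.torMatrix g nabla e p (U a p)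
          - S.torMatrix g nabla e p (U a p) * conFrame g nabla e p (Z p))).trace = 0 := by
  have hO := F.isOpen
  have sJ : SmoothMat n (fun q ↦ S.J e (η b) q) O := fun i j ↦ F.smooth_J b i j
  have sT : SmoothMat n (fun q ↦ S.torMatrix g nabla e q (U a q)) O := fun i j ↦ F.smooth_T a i j
  have h1 := dFun_trace hO hp (sJ.mul sT) (Z p)
  rw [dFun_eq_zero hO hp fun q hq ↦ F.trace_J_mul_T hq b a, dMat_mul hO hp sJ sT,
    F.dMat_J hp b hZ] at h1
  simp only [sub_mul, add_mul, neg_mul, Finset.sum_mul, smul_mul_assoc, Matrix.trace_add,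
    Matrix.trace_sub, Matrix.trace_neg, Matrix.trace_sum, Matrix.trace_smul,
    F.trace_J_mul_T hp, smul_zero, Finset.sum_const_zero, neg_zero, zero_add] at h1
  simp only [mul_sub, mul_add, Matrix.trace_add, Matrix.trace_sub, ← mul_assoc]
  have h2 : (S.J e (η b) p * S.torMatrix g nabla e p (U a p) * conFrame g nabla e p (Z p)).trace =
      (conFrame g nabla e p (Z p) * S.J e (η b) p * S.torMatrix g nabla e p (U a p)).trace := by
    rw [Matrix.trace_mul_comm, ← mul_assoc]
  have h3 : (0 : TangentSpace (𝓡 n) p →L[ℝ] ℝ) (Z p) = 0 := rfl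
  rw [h3] at h1
  rw [h2]
  linarith

theorem trace_J_curvFrame [T2Space M] (F : IsBiquardFrame S V g nabla O e η U)
    (hV : IsInvolutive V) (hp : p ∈ O) (a b c : Fin 3) :
    (S.J e (η b) p * curvFrame g nabla e (toField (U c)) (toField (U a)) p).trace =
      (S.J e (η b) p * (S.torMatrix g nabla e p (U a p) * S.torMatrix g nabla e p (U c p)
        - S.torMatrix g nabla e p (U c p) * S.torMatrix g nabla e p (U a p))).trace := by
  rw [F.curvFrame_vertical hV hp]
  exact trace_mul_sub_sum (F.trace_J_derivative hp a b (F.smooth_U c))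
    (F.trace_J_derivative hp c b (F.smooth_U a)) fun d ↦ F.trace_J_mul_T hp b d

/-- The curvature of `V` in terms of that of `H`. -/
theorem curvFrame_U_eq [T2Space M] (F : IsBiquardFrame S V g nabla O e η U) (hp : p ∈ O)
    {b c : Fin 3} {L : Matrix (Fin h) (Fin h) ℝ} (hbc : S.J e (η b) p * S.J e (η c) p = L)
    (hcb : S.J e (η c) p * S.J e (η b) p = -L)
    {X Y : VField n M} (hX : SmoothField X O) (hY : SmoothField Y O) :
    (h : ℝ) * curvFrame g nabla U X Y p c b =
      -2 * (L * curvFrame g nabla e X Y p).trace := by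
  -- Pairing with `J_b` isolates one component of the right-hand side, while cyclicity and `J_c J_b
  -- = -J_b J_c` double the left-hand side.
  have h1 := congrArg (fun A ↦ (S.J e (η b) p * A).trace) (F.commutator_curvature hp c hX hY)
  have h2 : (S.J e (η b) p * curvFrame g nabla e X Y p * S.J e (η c) p).trace =
      -(L * curvFrame g nabla e X Y p).trace := by
    rw [Matrix.trace_mul_comm, ← mul_assoc, hcb, neg_mul, Matrix.trace_neg]
  simp only [mul_sub, Matrix.trace_sub, h2, ← mul_assoc, hbc, Finset.mul_sum, mul_smul_comm,
    Matrix.trace_sum, Matrix.trace_smul, F.trace_J_mul_J hp] at h1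
  simp only [delta, mul_ite, mul_one, mul_zero, smul_eq_mul, Finset.sum_ite_eq, Finset.mem_univ,
    if_true] at h1
  linarith

end IsBiquardFrame
end VerticalCurvature

theorem sum_eq_of_distinct {E : Type*} [AddCommMonoid E] {a b c : Fin 3} (hab : a ≠ b)
    (hbc : b ≠ c) (hca : c ≠ a) (f : Fin 3 → E) : ∑ d, f d = f a + f b + f c := by
  fin_cases a <;> fin_cases b <;> fin_cases c <;> simp_all [Fin.sum_univ_three] <;> abel

/-! ### The trace identity for the reversed triple. -/

section TraceTorsion

open Matrix

variable {h : ℕ} {I J K : Matrix (Fin h) (Fin h) ℝ}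

theorem matInner_comm (A B : Matrix (Fin h) (Fin h) ℝ) : matInner A B = matInner B A := by
  rw [matInner, ← trace_transpose, transpose_mul, transpose_transpose, matInner]

/-- The variant of `trace_torsion` with the roles of `I` and `J` exchanged. -/
theorem trace_torsion_swap (hq : IsQuaternionTriple I J K)
    (hJ : J.transpose = -J) {T₁ T₂ T₃ : Matrix (Fin h) (Fin h) ℝ}
    (h11 : I * T₁ + T₁.transpose * I = 0) (h22 : J * T₂ + T₂.transpose * J = 0)
    (h33 : K * T₃ + T₃.transpose * K = 0)
    (h12 : J * T₁ + T₁.transpose * J + (I * T₂ + T₂.transpose * I) = 0)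
    (h13 : K * T₁ + T₁.transpose * K + (I * T₃ + T₃.transpose * I) = 0)
    (hP₁ : skewPart T₁ = I * skewPart T₁ * I + J * skewPart T₁ * J + K * skewPart T₁ * K)
    (hP₂ : skewPart T₂ = I * skewPart T₂ * I + J * skewPart T₂ * J + K * skewPart T₂ * K)
    (hP₃ : skewPart T₃ = I * skewPart T₃ * I + J * skewPart T₃ * J + K * skewPart T₃ * K) :
    (J * (T₂ * T₃ - T₃ * T₂)).trace = -2 * matInner (symPart T₁) (symPart T₂) := by
  have hneg : skewPart (-T₃) = -skewPart T₃ := by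
    simp only [skewPart, transpose_neg]; module
  -- The triple `(J, I, -K)` is quaternionic, and its third torsion matrix is `-T₃`; both signs
  -- cancel in `h33`, and one sign survives in the commutator.
  have := (trace_torsion hq.swap hJ (T₁ := T₂) (T₂ := T₁) (T₃ := -T₃) h22 h11
    (by simpa using h33) (by rw [add_comm]; exact h12)
    (by rw [← neg_eq_zero, ← h13]; simp only [transpose_neg]; noncomm_ring)
    (by nth_rewrite 1 [hP₂]; noncomm_ring) (by nth_rewrite 1 [hP₁]; noncomm_ring)
    (by rw [hneg]; nth_rewrite 1 [hP₃]; noncomm_ring)).1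
  rw [matInner_comm] at this
  simp only [mul_neg, neg_mul, sub_neg_eq_add, mul_add, trace_add, trace_neg] at this
  rw [mul_sub, trace_sub]
  linarith

end TraceTorsion

/-! ### The Bianchi identity on three vertical vectors, and the vertical Ricci tensor. -/

section VerticalRicci

open VectorField

set_option linter.unusedSectionVars false

variable {n h : ℕ} {M : Type*} [TopologicalSpace M]
  [ChartedSpace (EuclideanSpace ℝ (Fin n)) M] [IsManifold (𝓡 n) ∞ M]
  {S : SubRiemannian n h M} {V : Distribution n M} {g : SubRiemannian.Metric n M}
  {nabla : Connection n M} {O : Set M} {e : Fin h → Π q : M, S.H q} {η : Fin 3 → OneForm n M}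
  {U : Fin 3 → Π q : M, V q} {q p : M}

theorem curvMatrix_swap {ι : Type*} [Fintype ι] (f : ι → VField n M) (X Y : VField n M) :
    curvMatrix g nabla f X Y p = -curvMatrix g nabla f Y X p := by
  have h : conMatrix g nabla f p (mlieBracket (𝓡 n) X Y p) =
      -conMatrix g nabla f p (mlieBracket (𝓡 n) Y X p) := by
    ext k i
    simp only [conMatrix, Matrix.of_apply, Matrix.neg_apply]
    rw [mlieBracket_swap_apply, map_neg, map_neg, _root_.neg_apply]
  simp only [curvMatrix, h]
  abel

namespace IsBiquardFrame

theorem skewPart_torsion (F : IsBiquardFrame S V g nabla O e η U) (hq : q ∈ O)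
    (hquat : IsQuaternionTriple (S.J e (η 0) q) (S.J e (η 1) q) (S.J e (η 2) q)) (a : Fin 3) :
    skewPart (S.torMatrix g nabla e q (U a q)) =
      ∑ d, S.J e (η d) q * skewPart (S.torMatrix g nabla e q (U a q)) * S.J e (η d) q := by
  rw [Fin.sum_univ_three]
  refine skewPart_eq_of_inTPerpSym hquat (F.J_skew hq 0) (F.J_skew hq 1) (F.J_skew hq 2) ?_
    (F.biquard.torsion_V O F.isOpen e η F.frame F.coframe q hq (U a q) (U a q).2)
  congr 1
  ext A
  simp [Set.mem_range, Fin.exists_fin_succ, eq_comm]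

/-- The vertical torsion component of the first Bianchi identity on vertical vectors. -/
theorem vertical_bianchi [T2Space M] (F : IsBiquardFrame S V g nabla O e η U)
    (hV : IsInvolutive V) (hp : p ∈ O)
    (hquat : ∀ q ∈ O,
      IsQuaternionTriple (S.J e (η 0) q) (S.J e (η 1) q) (S.J e (η 2) q))
    {a b c : Fin 3} (hab : a ≠ b) (hbc : b ≠ c) (hca : c ≠ a) :
    curvFrame g nabla U (toField (U c)) (toField (U a)) p c b
        - curvFrame g nabla U (toField (U c)) (toField (U b)) p c a =
      dFun (n := n) (fun q ↦ vertTor g nabla U q a b c) p (U c p) := by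
  have hO := F.isOpen
  have hn := F.biquard.smooth
  have anti := fun {q} (hq : q ∈ O) ↦ F.vertTor_antisymm_right hV hq (hquat q hq)
  have self : ∀ {q}, q ∈ O → ∀ a b, vertTor g nabla U q a b b = 0 := fun hq a b ↦ by
    have := anti hq a b b; linarith
  have self' : ∀ {q}, ∀ a b, vertTor g nabla U q a a b = 0 := fun {q} a b ↦ by
    have := vertTor_antisymm (g := g) (nabla := nabla) (U := U) (q := q) a a b; linarith
  have self'' : ∀ {q}, q ∈ O → ∀ a b, vertTor g nabla U q a b a = 0 := fun {q} hq a b ↦ by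
    rw [vertTor_antisymm, self hq, neg_zero]
  -- Total antisymmetry leaves one component, as in a cross product: `Tor(U_a, U_b) = t_abc U_c`.
  have tor : ∀ {a b c : Fin 3}, a ≠ b → b ≠ c → c ≠ a → ∀ q ∈ O,
      nabla.torField (toField (U a)) (toField (U b)) q =
        ((fun q ↦ vertTor g nabla U q a b c) • toField (U c)) q := by
    intro a b c hab hbc hca q hq
    rw [show nabla.torField (toField (U a)) (toField (U b)) q = _ from F.torsion_UU hV hq a b,
      sum_eq_of_distinct hab hbc hca, self hq, self'' hq]
    simp
  have cyc : ∀ q ∈ O, ∀ a b c, vertTor g nabla U q b c a = vertTor g nabla U q a b c :=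
    fun q hq a b c ↦ by rw [anti hq, vertTor_antisymm, neg_neg]
  have dt : ∀ {a b c : Fin 3}, a ≠ b → b ≠ c → c ≠ a → ∀ (v : TangentSpace (𝓡 n) p) (d : Fin 3),
      g.inner p (nabla (nabla.torField (toField (U a)) (toField (U b))) p v) (U d p) =
        vertTor g nabla U p a b c * conFrame g nabla U p v d c +
          dFun (fun q ↦ vertTor g nabla U q a b c) p v * delta c d := by
    intro a b c hab hbc hca v d
    rw [nabla.congr hO (.torField hn hO (F.smooth_U a) (F.smooth_U b)) (tor hab hbc hca) hp,
      Connection.smul_apply hO hp (F.smooth_vertTor a b c) (F.smooth_U c)]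
    simp only [map_add, map_smul, _root_.add_apply, _root_.smul_apply, smul_eq_mul,
      F.orthonormal p hp, F.nabla_U hp, F.inner_sum_U hp]
  have br : ∀ x a b d : Fin 3, g.inner p (nabla.torsion p (U x p)
      (mlieBracket (𝓡 n) (toField (U a)) (toField (U b)) p)) (U d p) =
      ∑ y, (conFrame g nabla U p (U a p) y b - conFrame g nabla U p (U b p) y a
        - vertTor g nabla U p a b y) * vertTor g nabla U p x y d := by
    intro x a b d
    rw [F.bracket_UU hV hp]
    simp only [map_sum, map_smul, _root_.sum_apply, _root_.smul_apply, smul_eq_mul]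
    rfl
  have hb := Connection.first_bianchi hn hO hp (F.smooth_U a) (F.smooth_U b) (F.smooth_U c)
  rw [F.curvature_U hp (F.smooth_U a) (F.smooth_U b),
    F.curvature_U hp (F.smooth_U b) (F.smooth_U c),
    F.curvature_U hp (F.smooth_U c) (F.smooth_U a)] at hb
  have hb := congrArg (fun v ↦ g.inner p v (U c p)) hb
  simp only [map_add, _root_.add_apply, F.inner_sum_U hp] at hb
  rw [br a b c c, br b c a c, br c a b c, dt hab hbc hca, dt hbc hca hab, dt hca hab hbc] at hb
  have hcc : curvFrame g nabla U (toField (U a)) (toField (U b)) p c c = 0 := by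
    have := congrFun (congrFun (curvMatrix_skew hO (fun q hq ↦ F.skew_U hq) hp
      (toField (U a)) (toField (U b))) c) c
    rw [Matrix.transpose_apply, Matrix.neg_apply] at this
    linarith
  have hcon : ∀ v x y, conFrame g nabla U p v x y = -conFrame g nabla U p v y x := fun v x y ↦
    congrFun (congrFun (F.skew_U hp v) y) x
  have hdiag : ∀ v x, conFrame g nabla U p v x x = 0 := fun v x ↦ by
    have := hcon v x x; linarith
  have hswap : curvFrame g nabla U (toField (U b)) (toField (U c)) p c a =
      -curvFrame g nabla U (toField (U c)) (toField (U b)) p c a :=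
    congrFun (congrFun (curvMatrix_swap _ _ _) c) a
  -- Quadratic torsion terms vanish by antisymmetry, and the connection terms from `dt` and `br`
  -- cancel in pairs by skewness.
  simp only [sum_eq_of_distinct hab hbc hca, self hp, self', self'' hp, hdiag, hcc, hswap,
    cyc p hp, delta, hbc, hca.symm, if_true, if_false] at hb
  rw [vertTor_antisymm b a c, hcon _ c a, hcon _ c b] at hb
  linarith

/-- The vertical Ricci tensor and the derivative of the vertical torsion for a positively oriented
frame. -/
theorem verticalRicci_eq [T2Space M] (F : IsBiquardFrame S V g nabla O e η U)
    (hV : IsInvolutive V) (hp : p ∈ O)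
    (hquat : ∀ q ∈ O,
      IsQuaternionTriple (S.J e (η 0) q) (S.J e (η 1) q) (S.J e (η 2) q))
    {a b c : Fin 3} (hab : a ≠ b) (hbc : b ≠ c) (hca : c ≠ a)
    (hq : IsQuaternionTriple (S.J e (η a) p) (S.J e (η b) p) (S.J e (η c) p)) :
    verticalRicci g nabla (fun d ↦ toField (U d)) (toField (U a)) (toField (U b)) p =
        -(4 / (h : ℝ)) * matInner (symPart (S.torMatrix g nabla e p (U a p)))
            (symPart (S.torMatrix g nabla e p (U b p))) ∧
      matInner (skewPart (S.torMatrix g nabla e p (U a p)))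
            (skewPart (S.torMatrix g nabla e p (U b p))) = 0 ∧
      dFun (n := n) (fun q ↦ vertTor g nabla U q a b c) p (U c p) = 0 := by
  have hh : (h : ℝ) ≠ 0 := by exact_mod_cast rank_ne_zero S F.coframe hp
  have hD := F.torsion_diagonal hV hp (hquat p hp)
  have hC := F.torsion_constraint hV hp (hquat p hp)
  have hP := F.skewPart_torsion hp (hquat p hp)
  simp only [sum_eq_of_distinct hab hbc hca] at hP
  obtain ⟨t1, t0⟩ := trace_torsion hq (F.J_skew hp a) (hD a) (hD b) (hD c) (hC a b) (hC b c)
    (hP a) (hP b) (hP c)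
  have t2 := trace_torsion_swap hq (F.J_skew hp b) (hD a) (hD b) (hD c) (hC a b) (hC a c)
    (hP a) (hP b) (hP c)
  have c1 := F.curvFrame_U_eq hp (b := b) (c := c) hq.JK hq.KJ (F.smooth_U c) (F.smooth_U a)
  have c2 := F.curvFrame_U_eq hp (b := a) (c := c) hq.IK (by rw [hq.KI, neg_neg])
    (F.smooth_U c) (F.smooth_U b)
  rw [F.trace_J_curvFrame hV hp, t1] at c1
  rw [neg_mul (S.J e (η b) p), Matrix.trace_neg, F.trace_J_curvFrame hV hp, t2] at c2
  -- Only `d = c` contributes: `d = a` repeats a curvature direction, and `d = b` is a diagonal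
  -- entry of a skew matrix.
  have hsum : verticalRicci g nabla (fun d ↦ toField (U d)) (toField (U a)) (toField (U b)) p =
      curvFrame g nabla U (toField (U c)) (toField (U a)) p c b := by
    have haa : curvFrame g nabla U (toField (U a)) (toField (U a)) p a b = 0 := by
      have : curvFrame g nabla U (toField (U a)) (toField (U a)) p a b =
          -curvFrame g nabla U (toField (U a)) (toField (U a)) p a b :=
        congrFun (congrFun (curvMatrix_swap _ _ _) a) b
      linarith
    have hbb : curvFrame g nabla U (toField (U b)) (toField (U a)) p b b = 0 := by
      have := congrFun (congrFun (curvMatrix_skew F.isOpen (fun q hq ↦ F.skew_U hq) hp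
        (toField (U b)) (toField (U a))) b) b
      rw [Matrix.transpose_apply, Matrix.neg_apply] at this
      linarith
    rw [verticalRicci, sum_eq_of_distinct hab hbc hca,
      F.curvature_U hp (F.smooth_U a) (F.smooth_U a),
      F.curvature_U hp (F.smooth_U b) (F.smooth_U a),
      F.curvature_U hp (F.smooth_U c) (F.smooth_U a), F.inner_sum_U hp, F.inner_sum_U hp,
      F.inner_sum_U hp, haa, hbb, zero_add, zero_add]
  refine ⟨?_, t0, ?_⟩
  · rw [hsum]
    field_simp
    linarith
  -- By `c1` and `c2` the two curvature components have the same value, so their difference is zero.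
  · rw [← F.vertical_bianchi hV hp hquat hab hbc hca]
    exact mul_left_cancel₀ hh (by linarith)

end IsBiquardFrame

/-- Matrices with `J_a J_b J_c = -1` form a cyclic permutation of a quaternion triple. -/
theorem IsQuaternionTriple.cyclic {h : ℕ} (hh : h ≠ 0) {J : Fin 3 → Matrix (Fin h) (Fin h) ℝ}
    (hq : IsQuaternionTriple (J 0) (J 1) (J 2)) {a b c : Fin 3} (habc : J a * J b * J c = -1) :
    (a = 0 ∧ b = 1 ∧ c = 2) ∨ (a = 1 ∧ b = 2 ∧ c = 0) ∨ (a = 2 ∧ b = 0 ∧ c = 1) := by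
  have : Nonempty (Fin h) := ⟨⟨0, Nat.pos_of_ne_zero hh⟩⟩
  have h1 : (1 : Matrix (Fin h) (Fin h) ℝ) ≠ -1 := fun h1 ↦ by
    have := congrArg Matrix.trace h1
    rw [Matrix.trace_neg, Matrix.trace_one, Fintype.card_fin] at this
    have : (h : ℝ) = 0 := by linarith
    exact hh (by exact_mod_cast this)
  have hJ : ∀ d, J d * J d = -1 := fun d ↦ by fin_cases d; exacts [hq.II, hq.JJ, hq.KK]
  have h2 : ∀ d, J d ≠ 1 := fun d hd ↦ h1 (by have := hJ d; rwa [hd, one_mul] at this)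
  have h3 : ∀ d, J d ≠ -1 := fun d hd ↦ h1 (by have := hJ d; rw [hd] at this; simpa using this)
  -- A repeated index would make some `J_d` equal to `1` or `-1`, contradicting `J_d² = -1`; an odd
  -- permutation has product `1`.
  fin_cases a <;> fin_cases b <;> fin_cases c <;>
    simp_all [hq.II, hq.JJ, hq.KK, hq.IJ, hq.JK, hq.KI, hq.JI, hq.KJ, hq.IK]

end VerticalRicci

end QC

end

/-! ### Assembly over the three cyclic index triples. -/

theorem mainTheorem11 {n h : ℕ} {M : Type*} [TopologicalSpace M] [T2Space M]
    [ChartedSpace (EuclideanSpace ℝ (Fin n)) M] [IsManifold (𝓡 n) ∞ M]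
    (S : QC.SubRiemannian n h M) (hqc : S.IsQuaternionicContact) (hint : S.IsIntegrable)
    (V : QC.Distribution n M) (g : QC.SubRiemannian.Metric n M) (nabla : QC.Connection n M)
    (hB : S.IsBiquard V g nabla) (hV : QC.IsInvolutive V)
    (O : Set M) (hO : IsOpen O)
    (e : Fin h → Π q : M, S.H q) (he : S.IsOrthonormalFrame O e)
    (η : Fin 3 → QC.OneForm n M) (hη : S.IsCoframe O η)
    (U : Fin 3 → Π q : M, V q) (hU : QC.SubRiemannian.IsDualFrame O η U)
    (hUorth : ∀ q ∈ O, ∀ a b, g.inner q (U a q) (U b q) = QC.delta a b)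
    (hUor : ∀ q ∈ O, S.J e (η 0) q * S.J e (η 1) q * S.J e (η 2) q = -1) :
    ∀ p ∈ O, ∀ a b c : Fin 3, S.J e (η a) p * S.J e (η b) p * S.J e (η c) p = -1 →
      QC.verticalRicci g nabla (fun d ↦ QC.toField (U d)) (QC.toField (U a)) (QC.toField (U b)) p =
        4 / (h : ℝ) * QC.matInner (QC.skewPart (S.torMatrix g nabla e p (U a p)))
            (QC.skewPart (S.torMatrix g nabla e p (U b p)))
        - 4 / (h : ℝ) * QC.matInner (QC.symPart (S.torMatrix g nabla e p (U a p)))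
            (QC.symPart (S.torMatrix g nabla e p (U b p)))
        + 1 / 2 * QC.dFun (n := n)
            (QC.verticalTorsion nabla η (fun d ↦ QC.toField (U d))) p (U c p) := by
  intro p hp a b c habc
  have F : QC.IsBiquardFrame S V g nabla O e η U := ⟨hO, hB, he, hη, hU, hUorth⟩
  have hquat : ∀ q ∈ O,
      QC.IsQuaternionTriple (S.J e (η 0) q) (S.J e (η 1) q) (S.J e (η 2) q) :=
    fun q hq ↦ F.quaternionTriple hqc hq (hUor q hq)
  have hcyc : ∀ q ∈ O, ∀ a b c,
      QC.vertTor g nabla U q b c a = QC.vertTor g nabla U q a b c := fun q hq a b c ↦ by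
    rw [F.vertTor_antisymm_right hV hq (hquat q hq), QC.IsBiquardFrame.vertTor_antisymm, neg_neg]
  have hτ : ∀ q ∈ O, QC.verticalTorsion nabla η (fun d ↦ QC.toField (U d)) q =
      -QC.vertTor g nabla U q 0 1 2 := fun q hq ↦ by
    rw [QC.verticalTorsion, F.eta_eq hq]; rfl
  have key : ∀ {a b c : Fin 3} (hab : a ≠ b) (hbc : b ≠ c) (hca : c ≠ a),
      QC.IsQuaternionTriple (S.J e (η a) p) (S.J e (η b) p) (S.J e (η c) p) →
      (∀ q ∈ O, QC.vertTor g nabla U q a b c = QC.vertTor g nabla U q 0 1 2) → _ :=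
    fun {a b c} hab hbc hca hq ht ↦ show
      QC.verticalRicci g nabla (fun d ↦ QC.toField (U d)) (QC.toField (U a)) (QC.toField (U b)) p =
        4 / (h : ℝ) * QC.matInner (QC.skewPart (S.torMatrix g nabla e p (U a p)))
            (QC.skewPart (S.torMatrix g nabla e p (U b p)))
        - 4 / (h : ℝ) * QC.matInner (QC.symPart (S.torMatrix g nabla e p (U a p)))
            (QC.symPart (S.torMatrix g nabla e p (U b p)))
        + 1 / 2 * QC.dFun (n := n)
            (QC.verticalTorsion nabla η (fun d ↦ QC.toField (U d))) p (U c p) by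
      obtain ⟨h1, h2, h3⟩ := F.verticalRicci_eq hV hp hquat hab hbc hca hq
      -- On `O` the component for `a, b, c` is the cyclically equal `t₀₁₂ = -τ`, so `h3` says that
      -- the derivative of `τ` along `U_c` is zero.
      rw [QC.dFun_congr hO hp ht] at h3
      rw [h1, h2, QC.dFun_congr hO hp hτ, QC.dFun_neg, h3]
      ring
  rcases (hquat p hp).cyclic (J := fun a ↦ S.J e (η a) p) (QC.rank_ne_zero S hη hp) habc with
    ⟨rfl, rfl, rfl⟩ | ⟨rfl, rfl, rfl⟩ | ⟨rfl, rfl, rfl⟩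
  · exact key (by decide) (by decide) (by decide) (hquat p hp) fun q hq ↦ rfl
  · exact key (by decide) (by decide) (by decide) (hquat p hp).rotate fun q hq ↦ hcyc q hq 0 1 2
  · exact key (by decide) (by decide) (by decide) (hquat p hp).rotate.rotate fun q hq ↦ by
      rw [hcyc q hq 1 2 0, hcyc q hq 0 1 2]
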